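/- Let $p$ be a prime, $F$ a field of characteristic $p$. A $p$-form over $F$ is a map $\varphi\colon V\to F$ on a finite-dimensional $F$-vector space $V$ with $\varphi(av)=a^p\varphi(v)$ and $\varphi(v+w)=\varphi(v)+\varphi(w)$ for all $a\in F$, $v,w\in V$; $\dim\varphi=\dim_F V$; $\varphi$ is anisotropic if $\varphi(v)=0$ only for $v=0$. Isometry ($\simeq$) is a linear isomorphism of the underlying spaces compatible with the forms; a subform of $\psi$ is a form that admits an injective linear map to $\psi$ compatible with the forms. Every $\varphi$ is isometric to $\varphi_{\mathrm{an}}\perp k\times\langle 0\rangle$ with $\varphi_{\mathrm{an}}$ anisotropic and $k\ge 0$; $\varphi_{\mathrm{an}}$, the anisotropic part, is unique up to isometry. For a field extension $E/F$, $\varphi_E$ is the $p$-form on $E\otimes_F V$ with $\varphi_E(e\otimes v)=e^p\varphi(v)$, and the full splitting pattern of $\varphi$ is $$\mathrm{fSP}(\varphi)=\{\dim(\varphi_E)_{\mathrm{an}} \mid E/F \text{ a field extension}\}.$$ An $n$-fold quasi-Pfister form is a form isometric to the $p^n$-dimensional diagonal form $\langle\langle a_1,\dots,a_n\rangle\rangle=\bigotimes_{i=1}^n\langle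 1,a_i,\dots,a_i^{p-1}\rangle$ with coefficients $\prod_i a_i^{e_i}$, $0\le e_i\le p-1$, for some $a_1,\dots,a_n\in F$ (for $n=0$ it is $\langle 1\rangle$). An anisotropic $p$-form $\sigma$ is minimal if $[N_F(\sigma):F^p]=p^{\dim\sigma-1}$, where $N_F(\sigma)=F^p(a/b\mid a,b \text{ nonzero values of }\sigma)$. **Theorem.** Let $\pi$ be an $n$-fold quasi-Pfister form over $F$, let $\sigma$ be a minimal subform of $\pi$ with $\dim\sigma\ge 2$, and let $d\in F^*$ be such that the $p$-form $\varphi\simeq\pi\perp d\sigma$ is anisotropic. Then $m\in\mathrm{fSP}(\varphi)$ if and only if $m=p^k+\ell$ for some integers $k,\ell$ with $0\le k\le n$ and either 1. $\ell=0$, or 2. $\max\{1,\,k-n+\dim\sigma\}\le \ell\le\min\{\dim\sigma,\,p^k\}$. Moreover, every $m\in\mathrm{fSP}(\varphi)$ is realized over an extension of the form $K=F(\sqrt[p]{b_1},\dots,\sqrt[p]{b_r})$ with $b_1,\dots,b_r\in F$, that is, over a finite purely inseparable extension of exponent at most one ($K^p\subseteq F$): $m=\dim(\varphi_K)_{\mathrm{an}}$.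 -/

import Mathlib

open scoped TensorProduct

universe u v w

/-- A quasilinear `p`-form on an `F`-vector space `V`: an additive map `φ : V → F` with
`φ (a v) = a ^ p φ v`. (Finite-dimensionality of `V` is assumed where the form is used.) -/
structure PForm (p : ℕ) (F : Type*) (V : Type*) [Field F] [AddCommGroup V] [Module F V]
    extends V →+ F where
  map_smul' : ∀ (a : F) (v : V), toFun (a • v) = a ^ p * toFun v

namespace PForm

section Basic

variable {p : ℕ} {F : Type*} [Field F]
variable {V W : Type*} [AddCommGroup V] [Module F V] [AddCommGroup W] [Module F W]

instance : CoeFun (PForm p F V) (fun _ => V → F) := ⟨fun φ => φ.toFun⟩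

/-- Isometry of `p`-forms, `φ ≃ ψ`. -/
def Isometric (φ : PForm p F V) (ψ : PForm p F W) : Prop :=
  ∃ f : V ≃ₗ[F] W, ∀ v, φ v = ψ (f v)

/-- `φ` is a subform of `ψ`, `φ ⊆ ψ`. -/
def IsSubform (φ : PForm p F V) (ψ : PForm p F W) : Prop :=
  ∃ f : V →ₗ[F] W, Function.Injective f ∧ ∀ v, φ v = ψ (f v)

/-- `φ` is anisotropic: it has no nontrivial zero. -/
def Anisotropic (φ : PForm p F V) : Prop :=
  ∀ v, φ v = 0 → v = 0

/-- The orthogonal sum `φ ⊥ ψ`. -/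
def orthSum (φ : PForm p F V) (ψ : PForm p F W) : PForm p F (V × W) where
  toAddMonoidHom := φ.toAddMonoidHom.coprod ψ.toAddMonoidHom
  map_smul' a x := by
    have h₁ := φ.map_smul' a x.1
    have h₂ := ψ.map_smul' a x.2
    simp only [ZeroHom.toFun_eq_coe, AddMonoidHom.toZeroHom_coe] at h₁ h₂
    simp [AddMonoidHom.coprod_apply, h₁, h₂, mul_add]

/-- The scaled form `c φ`. -/
def scale (c : F) (φ : PForm p F V) : PForm p F V where
  toAddMonoidHom := (AddMonoidHom.mulLeft c).comp φ.toAddMonoidHom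
  map_smul' a v := by
    have h := φ.map_smul' a v
    simp only [ZeroHom.toFun_eq_coe, AddMonoidHom.toZeroHom_coe] at h
    simp [h, mul_left_comm]

/-- The zero form on `V`; on `Fin k → F` it is `k × ⟨0⟩`. -/
def zeroForm (p : ℕ) (F V : Type*) [Field F] [AddCommGroup V] [Module F V] : PForm p F V where
  toAddMonoidHom := 0
  map_smul' a v := by simp

/-- `ψ` is an anisotropic part of `φ`: it is anisotropic and `φ ≃ ψ ⊥ k × ⟨0⟩` for some `k`. -/
def IsAnisotropicPart (ψ : PForm p F W) (φ : PForm p F V) : Prop :=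
  ψ.Anisotropic ∧ ∃ k : ℕ, φ.Isometric (ψ.orthSum (zeroForm p F (Fin k → F)))

end Basic

section Field

variable {p : ℕ} [Fact p.Prime] {F : Type*} [Field F] [CharP F p]
variable {V : Type*} [AddCommGroup V] [Module F V]

/-- The diagonal form `⟨a i⟩_i`, that is `x ↦ ∑ i, a i * x i ^ p`. -/
def diag (p : ℕ) [Fact p.Prime] {F : Type*} [Field F] [CharP F p] {ι : Type*} [Fintype ι]
    (a : ι → F) : PForm p F (ι → F) where
  toFun x := ∑ i, a i * x i ^ p
  map_zero' := by simp [(Fact.out : p.Prime).ne_zero]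
  map_add' x y := by simp [add_pow_char, mul_add, Finset.sum_add_distrib]
  map_smul' c x := by simp [mul_pow, Finset.mul_sum, mul_left_comm]

/-- The coefficients of `⟨⟨a₁, …, aₙ⟩⟩ = ⟨⟨a₁⟩⟩ ⊗ ⋯ ⊗ ⟨⟨aₙ⟩⟩` where `⟨⟨a⟩⟩ = ⟨1, a, …, a ^ (p - 1)⟩`:
one takes one coefficient of every factor, so they are the products `∏ i, a i ^ e i` with
`0 ≤ e i ≤ p - 1`. For `n = 0` there is a single coefficient, `1`. -/
def quasiPfisterCoeff (p : ℕ) {F : Type*} [Field F] {n : ℕ} (a : Fin n → F)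
    (e : Fin n → Fin p) : F :=
  ∏ i, a i ^ (e i : ℕ)

/-- Splitting off the first factor: the coefficients of `⟨⟨c, a₁, …, aₙ⟩⟩` are those of
`⟨⟨c⟩⟩ ⊗ ⟨⟨a₁, …, aₙ⟩⟩`. -/
theorem quasiPfisterCoeff_cons (p : ℕ) {F : Type*} [Field F] {n : ℕ} (c : F) (a : Fin n → F)
    (j : Fin p) (e : Fin n → Fin p) :
    quasiPfisterCoeff p (Fin.cons c a : Fin (n + 1) → F) (Fin.cons j e : Fin (n + 1) → Fin p) =
      c ^ (j : ℕ) * quasiPfisterCoeff p a e := by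
  simp [quasiPfisterCoeff, Fin.prod_univ_succ]

/-- `φ` is an `n`-fold quasi-Pfister form. -/
def IsQuasiPfister (n : ℕ) (φ : PForm p F V) : Prop :=
  ∃ a : Fin n → F, φ.Isometric (diag p (quasiPfisterCoeff p a))

/-- The subfield `F ^ p` of `F`. -/
abbrev pPowers (p : ℕ) [Fact p.Prime] (F : Type*) [Field F] [CharP F p] : Subfield F :=
  (frobenius F p).fieldRange

/-- The norm field `N_F(φ) = F ^ p (a / b | a, b nonzero values of φ)`. -/
def normField (φ : PForm p F V) : IntermediateField (pPowers p F) F :=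
  IntermediateField.adjoin (pPowers p F)
    {x : F | ∃ v w : V, φ v ≠ 0 ∧ φ w ≠ 0 ∧ x = φ v / φ w}

/-- The norm degree `[N_F(φ) : F ^ p]`. -/
noncomputable def normDegree (φ : PForm p F V) : ℕ :=
  Module.finrank (pPowers p F) φ.normField

/-- `φ` is minimal: it is anisotropic of norm degree `p ^ (dim φ - 1)`. (The equation is multiplied
by `p` to avoid truncated subtraction.) -/
def IsMinimal (φ : PForm p F V) : Prop :=
  φ.Anisotropic ∧ p * φ.normDegree = p ^ Module.finrank F V

/-- The form `φ_E` on `E ⊗ V`, with `φ_E (e ⊗ v) = e ^ p * φ v`. -/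
noncomputable def baseChange (E : Type*) [Field E] [Algebra F E] (φ : PForm p F V) :
    PForm p E (E ⊗[F] V) where
  toAddMonoidHom :=
    haveI : CharP E p := charP_of_injective_algebraMap (algebraMap F E).injective p
    TensorProduct.liftAddHom
      (((AddMonoidHom.mul (R := E)).comp (frobenius E p).toAddMonoidHom).compl₂
          ((algebraMap F E).toAddMonoidHom.comp φ.toAddMonoidHom))
      (by
        intro a e v
        have h := φ.map_smul' a v
        simp only [ZeroHom.toFun_eq_coe, AddMonoidHom.toZeroHom_coe] at h
        simp [h, frobenius_def, Algebra.smul_def, mul_pow]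
        ring)
  map_smul' a x := by
    have : CharP E p := charP_of_injective_algebraMap (algebraMap F E).injective p
    induction x using TensorProduct.induction_on with
    | zero => simp
    | tmul e v => simp [TensorProduct.smul_tmul', frobenius_def, mul_pow, mul_assoc]
    | add x y hx hy =>
      simp only [ZeroHom.toFun_eq_coe, AddMonoidHom.toZeroHom_coe] at hx hy ⊢
      rw [smul_add, map_add, map_add, hx, hy, mul_add]

theorem baseChange_tmul (E : Type*) [Field E] [Algebra F E] (φ : PForm p F V) (e : E) (v : V) :
    φ.baseChange E (e ⊗ₜ[F] v) = e ^ p * algebraMap F E (φ v) := by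
  simp [baseChange, frobenius_def]

/-- `dim (φ_E)_an = m`. -/
def AnisotropicDimOver (φ : PForm p F V) (E : Type*) [Field E] [Algebra F E] (m : ℕ) : Prop :=
  ∃ ψ : PForm p E (Fin m → E), ψ.IsAnisotropicPart (φ.baseChange E)

/-- The full splitting pattern `{dim (φ_E)_an | E / F a field extension}`. The extensions range over
a universe that is at least the one of `F`, and otherwise arbitrary. -/
def fullSplittingPattern {F : Type u} [Field F] [CharP F p]
    {V : Type w} [AddCommGroup V] [Module F V] (φ : PForm p F V) : Set ℕ :=
  {m | ∃ (E : Type (max u v)) (_ : Field E) (_ : Algebra F E), φ.AnisotropicDimOver E m}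

/-- The field `F(b₁^{1/p}, …, b_r^{1/p})`, inside an algebraic closure of `F`. -/
noncomputable def pthRootField (p : ℕ) {F : Type*} [Field F] {r : ℕ} (b : Fin r → F) :
    IntermediateField F (AlgebraicClosure F) :=
  IntermediateField.adjoin F {x | ∃ i, x ^ p = algebraMap F (AlgebraicClosure F) (b i)}

end Field

end PForm

/-! Everything is read off from values. The values of a `p`-form over `E` are an `E^p`-subspace of
`E` whose dimension is that of the anisotropic part, so dim (φ_E)_an is the dimension of the
`E^p`-span of D(φ) (`anisotropicDimOver_iff`). Here D(φ) = P + eS, where P = D(π) is a field of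
degree p^n over F^p, e ∉ P, and S ⊆ P is a rescaling of D(σ) that contains 1, has dimension s = dim
σ and generates a field N of degree p^(s-1) (`exists_valueSpace_decomposition`).

Let P_E = E^p(P), of degree p^j. The span of D(φ) is P_E + e·(E^p S). If e ∈ P_E, it is P_E.
Otherwise the sum is direct and has dimension p^j + l with l = dim E^p S. Clearly l ≤ s and l ≤ p^j.
As 1 ∈ S, the field E^p(S) needs at most l - 1 generators, and P needs n - s + 1 more over N, so j ≤
(l - 1) + (n - s + 1), the lower bound on l.

Conversely, Frobenius identifies K = F(b_1^(1/p), …) with B = F^p(b_1, …), so it suffices to find B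
inside F. For l = 0, B is generated by e and all but j of n generators of P (`exists_adjoin_mem`).
For l ≥ 1, B lies in P, hence e ∉ B(P) = P. Keep i = min(j, l - 1) basis elements of S free; they
generate a field J of degree p^i ≥ l. Choose W in J of dimension l containing 1 and these elements,
and let B make the rest of S congruent to elements of W. A degree count makes J and B linearly
disjoint, so dim BS = dim W = l (`exists_adjoin_finrank_span`). -/

namespace PForm

/-! ### Intermediate subspaces and complements -/

section LinearAlgebra

open Module

variable {k V : Type*} [Field k] [AddCommGroup V] [Module k V]

/-- The index type is arbitrary so that the generators can be split into blocks. Their independence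
is not recorded; it is recovered later by counting. -/
theorem exists_eq_sup_span {W₀ W : Submodule k V} [FiniteDimensional k W] (hle : W₀ ≤ W)
    {ι : Type*} [Fintype ι] (hfr : finrank k W = finrank k W₀ + Fintype.card ι) :
    ∃ u : ι → V, W = W₀ ⊔ Submodule.span k (Set.range u) := by
  obtain ⟨C, hC⟩ := Submodule.exists_isCompl W₀
  have h1 : W₀ ⊔ C ⊓ W = W := by
    rw [← sup_inf_assoc_of_le C hle, hC.sup_eq_top, top_inf_eq]
  have h2 : W₀ ⊓ (C ⊓ W) = ⊥ := by
    rw [← inf_assoc, hC.inf_eq_bot, bot_inf_eq]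
  have : FiniteDimensional k W₀ := Submodule.finiteDimensional_of_le hle
  have : FiniteDimensional k ↥(C ⊓ W) := Submodule.finiteDimensional_of_le inf_le_right
  have h3 := Submodule.finrank_sup_add_finrank_inf_eq W₀ (C ⊓ W)
  rw [h1, h2, finrank_bot] at h3
  have b := (finBasisOfFinrankEq k ↥(C ⊓ W) (n := Fintype.card ι) (by omega)).reindex
    (Fintype.equivFin ι).symm
  refine ⟨fun i => (b i : V), ?_⟩
  have h4 : Submodule.span k (Set.range fun i => (b i : V)) = C ⊓ W := by
    have := congrArg (Submodule.map (C ⊓ W).subtype) b.span_eq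
    rw [Submodule.map_span, ← Set.range_comp, Submodule.map_top, Submodule.range_subtype] at this
    exact this
  rw [h4, h1]

/-- A subspace of given dimension between two subspaces. -/
theorem exists_between_finrank {W₀ W : Submodule k V} [FiniteDimensional k W] (hle : W₀ ≤ W)
    {l : ℕ} (h₁ : finrank k W₀ ≤ l) (h₂ : l ≤ finrank k W) :
    ∃ W₁, W₀ ≤ W₁ ∧ W₁ ≤ W ∧ finrank k W₁ = l := by
  induction l, h₁ using Nat.le_induction with
  | base => exact ⟨W₀, le_rfl, hle, rfl⟩
  | succ l hl ih =>
    obtain ⟨W₁, h01, h1W, hfr⟩ := ih (by omega)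
    have : FiniteDimensional k W₁ := Submodule.finiteDimensional_of_le h1W
    obtain ⟨x, hxW, hx⟩ : ∃ x ∈ W, x ∉ W₁ := by
      by_contra! hcon
      rw [le_antisymm h1W hcon] at hfr
      omega
    refine ⟨W₁ ⊔ k ∙ x, h01.trans le_sup_left,
      sup_le h1W ((Submodule.span_singleton_le_iff_mem _ _).2 hxW), ?_⟩
    have h3 := Submodule.finrank_sup_add_finrank_inf_eq W₁ (k ∙ x)
    have h4 : W₁ ⊓ k ∙ x = ⊥ :=
      disjoint_iff.1 ((Submodule.disjoint_span_singleton' (by rintro rfl; exact hx W₁.zero_mem)).2 hx)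
    rw [h4, finrank_bot, finrank_span_singleton (by rintro rfl; exact hx W₁.zero_mem)] at h3
    omega

end LinearAlgebra

/-! ### Degrees in extensions of exponent one -/

section ExponentOne

open IntermediateField Module

variable {p : ℕ} [Fact p.Prime] {k L : Type*} [Field k] [Field L] [Algebra k L]

theorem isAlgebraic_of_pow_mem (h : ∀ x : L, x ^ p ∈ (algebraMap k L).range) :
    Algebra.IsAlgebraic k L := by
  refine ⟨fun x => ?_⟩
  obtain ⟨a, ha⟩ := h x
  have hx : IsIntegral k (x ^ p) := ha ▸ isIntegral_algebraMap
  exact (IsIntegral.of_pow (Fact.out : p.Prime).pos hx).isAlgebraic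

/-- The span of a multiplicative submonoid is a field. -/
theorem span_eq_adjoin (h : ∀ x : L, x ^ p ∈ (algebraMap k L).range) (s : Submonoid L) :
    Submodule.span k (s : Set L) = (adjoin k (s : Set L)).toSubalgebra.toSubmodule := by
  have := isAlgebraic_of_pow_mem h
  rw [adjoin_toSubalgebra_of_isAlgebraic fun x _ => Algebra.IsAlgebraic.isAlgebraic x,
    Algebra.adjoin_eq_span, Submonoid.closure_eq]

variable [CharP L p]

/-- `X ^ p - x ^ p` is irreducible over `M`: otherwise `x ^ p` is a `p`-th power in `M`, and
injectivity of Frobenius puts `x` in `M`. -/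
theorem finrank_sup_adjoin_simple (h : ∀ x : L, x ^ p ∈ (algebraMap k L).range)
    (M : IntermediateField k L) {x : L} (hx : x ∉ M) :
    finrank k ↥(M ⊔ k⟮x⟯) = p * finrank k M := by
  have hp : p.Prime := Fact.out
  have := isAlgebraic_of_pow_mem h
  obtain ⟨a, ha⟩ := h x
  have hirr : Irreducible (Polynomial.X ^ p - Polynomial.C (algebraMap k M a)) := by
    refine X_pow_sub_C_irreducible_of_prime hp fun b hb => hx ?_
    have h1 : (b : L) ^ p = x ^ p := by
      rw [← ha, ← SubmonoidClass.coe_pow, hb]; rfl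
    have h2 : (b : L) = x := frobenius_inj L p h1
    exact h2 ▸ b.2
  have hmin := minpoly.eq_of_irreducible_of_monic (x := x) hirr
    (by simp only [map_sub, map_pow, Polynomial.aeval_X, Polynomial.aeval_C, ← ha]
        exact sub_self _)
    (Polynomial.monic_X_pow_sub_C _ hp.ne_zero)
  have hint : IsIntegral M x := (Algebra.IsIntegral.isIntegral (R := k) x).tower_top
  have h3 := adjoin.finrank hint
  rw [← hmin, Polynomial.natDegree_X_pow_sub_C] at h3
  rw [← restrictScalars_adjoin_eq_sup, mul_comm]
  have h4 := finrank_mul_finrank k M ↥(M⟮x⟯)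
  rw [h3] at h4
  exact h4.symm

theorem exists_finrank_sup_adjoin_finset (h : ∀ x : L, x ^ p ∈ (algebraMap k L).range)
    (M : IntermediateField k L) (s : Finset L) :
    ∃ c ≤ s.card, finrank k ↥(M ⊔ adjoin k (s : Set L)) = p ^ c * finrank k M := by
  classical
  induction s using Finset.induction_on with
  | empty =>
    refine ⟨0, le_rfl, ?_⟩
    rw [Finset.coe_empty, adjoin_empty, sup_bot_eq, pow_zero, one_mul]
  | insert x s hx ih =>
    obtain ⟨c, hc, hfr⟩ := ih
    have heq : M ⊔ adjoin k ((insert x s : Finset L) : Set L) =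
        (M ⊔ adjoin k (s : Set L)) ⊔ k⟮x⟯ := by
      rw [Finset.coe_insert, Set.insert_eq, adjoin_union, sup_assoc, sup_comm k⟮x⟯]
    rw [heq, Finset.card_insert_of_notMem hx]
    by_cases hxM : x ∈ M ⊔ adjoin k (s : Set L)
    · refine ⟨c, by omega, ?_⟩
      rw [sup_eq_left.2 (adjoin_simple_le_iff.2 hxM), hfr]
    · exact ⟨c + 1, by omega, by rw [finrank_sup_adjoin_simple h _ hxM, hfr, pow_succ']; ring⟩

/-- Adjoining `r` elements in exponent one multiplies the degree by `p ^ c` with `c ≤ r`. -/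
theorem exists_finrank_sup_adjoin (h : ∀ x : L, x ^ p ∈ (algebraMap k L).range)
    (M : IntermediateField k L) {ι : Type*} [Fintype ι] (u : ι → L) :
    ∃ c ≤ Fintype.card ι,
      finrank k ↥(M ⊔ adjoin k (Set.range u)) = p ^ c * finrank k M := by
  classical
  obtain ⟨c, hc, hfr⟩ := exists_finrank_sup_adjoin_finset h M (Finset.univ.image u)
  refine ⟨c, hc.trans Finset.card_image_le, ?_⟩
  rwa [Finset.coe_image, Finset.coe_univ, Set.image_univ] at hfr

theorem exists_finrank_adjoin (h : ∀ x : L, x ^ p ∈ (algebraMap k L).range)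
    {ι : Type*} [Fintype ι] (u : ι → L) :
    ∃ c ≤ Fintype.card ι, finrank k ↥(adjoin k (Set.range u)) = p ^ c := by
  obtain ⟨c, hc, hfr⟩ := exists_finrank_sup_adjoin h ⊥ u
  refine ⟨c, hc, ?_⟩
  rwa [bot_sup_eq, IntermediateField.finrank_bot, mul_one] at hfr

/-- Greedy choice of a `p`-basis: each element outside the current field multiplies the degree by
exactly `p`. A nonzero `finrank` encodes finite dimension. -/
theorem exists_eq_sup_adjoin_fin (h : ∀ x : L, x ^ p ∈ (algebraMap k L).range)
    {P : IntermediateField k L} (t : ℕ) : ∀ (M : IntermediateField k L), M ≤ P →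
    finrank k M ≠ 0 → finrank k P = p ^ t * finrank k M →
    ∃ u : Fin t → L, P = M ⊔ adjoin k (Set.range u) := by
  have hp : p.Prime := Fact.out
  induction t with
  | zero =>
    intro M hM h0 hfr
    have : FiniteDimensional k P := Module.finite_of_finrank_pos (by rw [hfr]; simpa using h0.bot_lt)
    exact ⟨Fin.elim0, by simpa using (eq_of_le_of_finrank_eq hM (by simpa using hfr.symm)).symm⟩
  | succ t ih =>
    intro M hM h0 hfr
    obtain ⟨x, hxP, hxM⟩ : ∃ x ∈ P, x ∉ M := by
      by_contra! hcon
      have : M = P := le_antisymm hM hcon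
      subst this
      have h1 : 1 < p ^ (t + 1) := Nat.one_lt_pow (by omega) hp.one_lt
      have h2 := Nat.mul_lt_mul_of_pos_right h1 h0.bot_lt
      simp only [one_mul, ← hfr, lt_irrefl] at h2
    have h1 := finrank_sup_adjoin_simple h M hxM
    obtain ⟨u, hu⟩ := ih (M ⊔ k⟮x⟯) (sup_le hM (adjoin_simple_le_iff.2 hxP))
      (by rw [h1]; exact mul_ne_zero hp.ne_zero h0) (by rw [h1, hfr, pow_succ, mul_assoc])
    refine ⟨Fin.cons x u, ?_⟩
    rw [hu, Fin.range_cons, Set.insert_eq, adjoin_union, sup_assoc]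

theorem exists_eq_sup_adjoin (h : ∀ x : L, x ^ p ∈ (algebraMap k L).range)
    {M P : IntermediateField k L} (hM : M ≤ P) (h0 : finrank k M ≠ 0) {ι : Type*} [Fintype ι]
    (hfr : finrank k P = p ^ Fintype.card ι * finrank k M) :
    ∃ u : ι → L, P = M ⊔ adjoin k (Set.range u) := by
  obtain ⟨u, hu⟩ := exists_eq_sup_adjoin_fin h _ M hM h0 hfr
  refine ⟨u ∘ Fintype.equivFin ι, ?_⟩
  rw [(Fintype.equivFin ι).surjective.range_comp, hu]

/-- The element 1 is free of charge as a field generator; this is the source of every `- 1` in the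
degree bounds. -/
theorem adjoin_eq_of_eq_sup_span {W : Submodule k L} {s : Set L}
    (hW : W = (k ∙ (1 : L)) ⊔ Submodule.span k s) : adjoin k (W : Set L) = adjoin k s := by
  refine le_antisymm (adjoin_le_iff.2 ?_) (adjoin.mono k s W fun x hx => ?_)
  · have : W ≤ (adjoin k s).toSubalgebra.toSubmodule := by
      rw [hW]
      exact sup_le ((Submodule.span_singleton_le_iff_mem _ _).2 (one_mem (adjoin k s)))
        (Submodule.span_le.2 (subset_adjoin k s))
    exact this
  · rw [hW]
    exact Submodule.mem_sup_right (Submodule.subset_span hx)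

/-- A space that contains `1` and has dimension `r + 1` generates a field of degree at most
`p ^ r`. -/
theorem exists_finrank_adjoin_submodule (h : ∀ x : L, x ^ p ∈ (algebraMap k L).range)
    (W : Submodule k L) [FiniteDimensional k W] (h1 : (1 : L) ∈ W) :
    ∃ c, c + 1 ≤ finrank k W ∧ finrank k ↥(adjoin k (W : Set L)) = p ^ c := by
  have hle : (k ∙ (1 : L)) ≤ W := (Submodule.span_singleton_le_iff_mem _ _).2 h1
  have h2 : finrank k ↥(k ∙ (1 : L)) = 1 := finrank_span_singleton one_ne_zero
  have h3 := Submodule.finrank_mono hle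
  obtain ⟨u, hu⟩ := exists_eq_sup_span (ι := Fin (finrank k W - 1)) hle
    (by rw [h2, Fintype.card_fin]; omega)
  obtain ⟨c, hc, hfr⟩ := exists_finrank_adjoin h u
  refine ⟨c, by rw [Fintype.card_fin] at hc; omega, ?_⟩
  rw [adjoin_eq_of_eq_sup_span hu, hfr]

end ExponentOne

/-! ### Value spaces and anisotropic parts -/

section Values

open Module

variable {p : ℕ} {F : Type*} [Field F]
variable {V W : Type*} [AddCommGroup V] [Module F V] [AddCommGroup W] [Module F W]

theorem map_zero (φ : PForm p F V) : φ 0 = 0 := φ.toAddMonoidHom.map_zero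

theorem map_add (φ : PForm p F V) (v w : V) : φ (v + w) = φ v + φ w :=
  φ.toAddMonoidHom.map_add v w

theorem map_smul (φ : PForm p F V) (a : F) (v : V) : φ (a • v) = a ^ p * φ v := φ.map_smul' a v

theorem map_sum (φ : PForm p F V) {ι : Type*} (s : Finset ι) (f : ι → V) :
    φ (∑ i ∈ s, f i) = ∑ i ∈ s, φ (f i) :=
  _root_.map_sum φ.toAddMonoidHom f s

/-- The isotropic vectors. -/
def radical (φ : PForm p F V) : Submodule F V where
  carrier := {v | φ v = 0}
  zero_mem' := φ.map_zero
  add_mem' := by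
    intro v w hv hw
    simp only [Set.mem_ofPred_eq] at hv hw ⊢
    rw [map_add, hv, hw, add_zero]
  smul_mem' := by
    intro a v hv
    simp only [Set.mem_ofPred_eq] at hv ⊢
    rw [map_smul, hv, mul_zero]

/-- Pullback along a linear map. -/
def comp (φ : PForm p F V) (f : W →ₗ[F] V) : PForm p F W where
  toAddMonoidHom := φ.toAddMonoidHom.comp f.toAddMonoidHom
  map_smul' a w := by
    have h := φ.map_smul' a (f w)
    simp only [ZeroHom.toFun_eq_coe, AddMonoidHom.toZeroHom_coe] at h
    simp [h]

/-- By additivity the isotropic vectors form a subspace, and the restriction to any complement is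
anisotropic. -/
theorem exists_isAnisotropicPart [FiniteDimensional F V] (φ : PForm p F V) :
    ∃ (m : ℕ) (ψ : PForm p F (Fin m → F)), ψ.IsAnisotropicPart φ := by
  obtain ⟨C, hC⟩ := Submodule.exists_isCompl φ.radical
  let e := (finBasis F C).equivFun
  let r := (finBasis F φ.radical).equivFun
  refine ⟨finrank F C, φ.comp (C.subtype ∘ₗ e.symm.toLinearMap), ?_, finrank F φ.radical, ?_⟩
  · intro v hv
    have h1 : (e.symm v : V) ∈ φ.radical ⊓ C := ⟨hv, (e.symm v).2⟩
    rw [hC.inf_eq_bot, Submodule.mem_bot, Submodule.coe_eq_zero] at h1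
    exact (LinearEquiv.map_eq_zero_iff _).1 h1
  · let g := (Submodule.prodEquivOfIsCompl C φ.radical hC.symm).symm ≪≫ₗ (e.prodCongr r)
    refine ⟨g, fun v => ?_⟩
    obtain ⟨⟨x, y⟩, rfl⟩ := (Submodule.prodEquivOfIsCompl C φ.radical hC.symm).surjective v
    have h1 : g (Submodule.prodEquivOfIsCompl C φ.radical hC.symm (x, y)) = (e x, r y) := by
      simp [g]
    rw [h1]
    have h2 : φ (y : V) = 0 := y.2
    have h3 : Submodule.prodEquivOfIsCompl C φ.radical hC.symm (x, y) = (x : V) + (y : V) := by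
      simp
    rw [h3, map_add, h2]
    change _ = φ (e.symm (e x) : V) + 0
    rw [e.symm_apply_apply]

variable [Fact p.Prime] [CharP F p]

theorem pow_mem_range_pPowers (x : F) : x ^ p ∈ (algebraMap (pPowers p F) F).range :=
  ⟨⟨x ^ p, x, rfl⟩, rfl⟩

/-- The values of a `p`-form, as a space over `F ^ p`. -/
def valueSpace (φ : PForm p F V) : Submodule (pPowers p F) F where
  carrier := Set.range φ
  zero_mem' := ⟨0, φ.map_zero⟩
  add_mem' := by
    rintro _ _ ⟨v, rfl⟩ ⟨w, rfl⟩
    exact ⟨v + w, φ.map_add v w⟩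
  smul_mem' := by
    rintro ⟨_, a, rfl⟩ _ ⟨v, rfl⟩
    exact ⟨a • v, φ.map_smul a v⟩

theorem mem_valueSpace {φ : PForm p F V} {x : F} : x ∈ φ.valueSpace ↔ ∃ v, φ v = x := Iff.rfl

theorem Isometric.valueSpace_eq {φ : PForm p F V} {ψ : PForm p F W} (h : φ.Isometric ψ) :
    φ.valueSpace = ψ.valueSpace := by
  obtain ⟨f, hf⟩ := h
  ext x
  rw [mem_valueSpace, mem_valueSpace]
  constructor
  · rintro ⟨v, rfl⟩
    exact ⟨f v, (hf v).symm⟩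
  · rintro ⟨w, rfl⟩
    exact ⟨f.symm w, by rw [hf, f.apply_symm_apply]⟩

theorem IsSubform.valueSpace_le {φ : PForm p F V} {ψ : PForm p F W} (h : φ.IsSubform ψ) :
    φ.valueSpace ≤ ψ.valueSpace := by
  obtain ⟨f, -, hf⟩ := h
  rintro _ ⟨v, rfl⟩
  exact ⟨f v, (hf v).symm⟩

theorem mem_valueSpace_orthSum {φ : PForm p F V} {ψ : PForm p F W} {x : F} :
    x ∈ (φ.orthSum ψ).valueSpace ↔ ∃ a ∈ φ.valueSpace, ∃ b ∈ ψ.valueSpace, x = a + b := by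
  constructor
  · rintro ⟨⟨v, w⟩, rfl⟩
    exact ⟨_, ⟨v, rfl⟩, _, ⟨w, rfl⟩, rfl⟩
  · rintro ⟨_, ⟨v, rfl⟩, _, ⟨w, rfl⟩, rfl⟩
    exact ⟨(v, w), rfl⟩

theorem mem_valueSpace_scale {c : F} {φ : PForm p F V} {x : F} :
    x ∈ (φ.scale c).valueSpace ↔ ∃ a ∈ φ.valueSpace, x = c * a := by
  constructor
  · rintro ⟨v, rfl⟩
    exact ⟨_, ⟨v, rfl⟩, rfl⟩
  · rintro ⟨_, ⟨v, rfl⟩, rfl⟩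
    exact ⟨v, rfl⟩

/-- An anisotropic form on `V` has `dim V` many independent values. -/
theorem Anisotropic.finrank_valueSpace [FiniteDimensional F V] {φ : PForm p F V}
    (h : φ.Anisotropic) : finrank (pPowers p F) φ.valueSpace = finrank F V := by
  set b := finBasis F V
  have hind : LinearIndependent (pPowers p F) fun i => φ (b i) := by
    rw [Fintype.linearIndependent_iff]
    intro g hg i
    -- Coefficients in `F ^ p` are `p`-th powers, so a relation among values says that a single
    -- vector is isotropic.
    choose c hc using fun i => (g i).2
    have h0 : φ (∑ i, c i • b i) = 0 := by
      rw [map_sum, ← hg]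
      refine Finset.sum_congr rfl fun i _ => ?_
      rw [map_smul, Subfield.smul_def, ← hc, frobenius_def, smul_eq_mul]
    have h1 := Fintype.linearIndependent_iff.1 b.linearIndependent c (h _ h0) i
    ext
    rw [← hc, h1, RingHom.map_zero]
    rfl
  have hspan : Submodule.span (pPowers p F) (Set.range fun i => φ (b i)) = φ.valueSpace := by
    refine le_antisymm (Submodule.span_le.2 ?_) ?_
    · rintro _ ⟨i, rfl⟩
      exact ⟨b i, rfl⟩
    · rintro _ ⟨v, rfl⟩
      rw [← b.sum_repr v, map_sum]
      refine Submodule.sum_mem _ fun i _ => ?_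
      rw [map_smul]
      exact Submodule.smul_mem _ (⟨_, _, rfl⟩ : pPowers p F) (Submodule.subset_span ⟨i, rfl⟩)
  have := finrank_span_eq_card hind
  rwa [hspan, Fintype.card_fin] at this

theorem IsAnisotropicPart.finrank_valueSpace {m : ℕ} {ψ : PForm p F (Fin m → F)}
    {φ : PForm p F V} (h : ψ.IsAnisotropicPart φ) : finrank (pPowers p F) φ.valueSpace = m := by
  obtain ⟨han, k, hk⟩ := h
  have h1 : (ψ.orthSum (zeroForm p F (Fin k → F))).valueSpace = ψ.valueSpace := by
    ext x
    rw [mem_valueSpace_orthSum]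
    constructor
    · rintro ⟨a, ha, _, ⟨w, rfl⟩, rfl⟩
      change a + 0 ∈ _
      rwa [add_zero]
    · intro hx
      exact ⟨x, hx, 0, zero_mem _, (add_zero x).symm⟩
  rw [hk.valueSpace_eq, h1, han.finrank_valueSpace, finrank_fin_fun]

end Values

/-! ### Anisotropic dimension as the dimension of a span -/

section BaseChange

open Module

variable {p : ℕ} [Fact p.Prime] {F : Type*} [Field F] [CharP F p]
variable {V : Type*} [AddCommGroup V] [Module F V]

theorem valueSpace_baseChange (φ : PForm p F V) (E : Type*) [Field E] [Algebra F E] [CharP E p] :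
    (φ.baseChange E).valueSpace =
      Submodule.span (pPowers p E) (algebraMap F E '' φ.valueSpace) := by
  refine le_antisymm ?_ (Submodule.span_le.2 ?_)
  · rintro _ ⟨x, rfl⟩
    induction x using TensorProduct.induction_on with
    | zero => rw [map_zero]; exact zero_mem _
    | tmul e v =>
      rw [baseChange_tmul]
      exact Submodule.smul_mem _ (⟨_, _, rfl⟩ : pPowers p E)
        (Submodule.subset_span ⟨_, ⟨v, rfl⟩, rfl⟩)
    | add x y hx hy => rw [map_add]; exact add_mem hx hy
  · rintro _ ⟨_, ⟨v, rfl⟩, rfl⟩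
    refine ⟨1 ⊗ₜ v, ?_⟩
    rw [baseChange_tmul, one_pow, one_mul]

theorem anisotropicDimOver_iff [FiniteDimensional F V] (φ : PForm p F V) (E : Type*) [Field E]
    [Algebra F E] [CharP E p] (m : ℕ) :
    φ.AnisotropicDimOver E m ↔
      finrank (pPowers p E) (Submodule.span (pPowers p E) (algebraMap F E '' φ.valueSpace)) = m := by
  rw [← valueSpace_baseChange]
  constructor
  · rintro ⟨ψ, hψ⟩
    exact hψ.finrank_valueSpace
  · intro hm
    obtain ⟨m', ψ, hψ⟩ := (φ.baseChange E).exists_isAnisotropicPart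
    have h := hψ.finrank_valueSpace.symm.trans hm
    subst h
    exact ⟨ψ, hψ⟩

/-- If the `p`-th powers of `E` are the images of the subfield `B` of `F`, then the anisotropic
dimension over `E` can be computed inside `F`. -/
theorem anisotropicDimOver_iff_of_subfield [FiniteDimensional F V] (φ : PForm p F V)
    (B : IntermediateField (pPowers p F) F) (E : Type*) [Field E] [Algebra F E]
    (hB : ∀ b ∈ B, ∃ x : E, x ^ p = algebraMap F E b)
    (hE : ∀ x : E, ∃ b ∈ B, x ^ p = algebraMap F E b) (m : ℕ) :
    φ.AnisotropicDimOver E m ↔ finrank B (Submodule.span B (φ.valueSpace : Set F)) = m := by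
  have : CharP E p := charP_of_injective_algebraMap (algebraMap F E).injective p
  rw [anisotropicDimOver_iff]
  -- The hypotheses say exactly that `algebraMap F E` restricts to an isomorphism of `B` with `E ^
  -- p`; semilinearly along it, the two spans correspond.
  let i₀ : B →+* pPowers p E := ((algebraMap F E).comp B.val.toRingHom).codRestrict (pPowers p E)
    fun b => by
      obtain ⟨x, hx⟩ := hB b b.2
      exact ⟨x, hx⟩
  have hi₀ : Function.Bijective i₀ := by
    refine ⟨i₀.injective, ?_⟩
    rintro ⟨_, x, rfl⟩
    obtain ⟨b, hb, hx⟩ := hE x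
    exact ⟨⟨b, hb⟩, Subtype.ext hx.symm⟩
  let i : B ≃+* pPowers p E := RingEquiv.ofBijective i₀ hi₀
  have hi : ∀ b : B, (i b : E) = algebraMap F E b := fun b => rfl
  let := RingHomInvPair.of_ringEquiv i
  let := RingHomInvPair.of_ringEquiv i.symm
  let f : F →ₛₗ[(i : B →+* pPowers p E)] E :=
    { toFun := algebraMap F E
      map_add' := RingHom.map_add _
      map_smul' := fun b x => by
        rw [Algebra.smul_def, RingHom.map_mul, Subfield.smul_def, smul_eq_mul]
        rfl }
  have hf : Function.Injective f := (algebraMap F E).injective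
  have hmap : Submodule.map f (Submodule.span B (φ.valueSpace : Set F)) =
      Submodule.span (pPowers p E) (algebraMap F E '' φ.valueSpace) :=
    Submodule.map_span f _
  let j := Submodule.equivMapOfInjective f hf (Submodule.span B (φ.valueSpace : Set F))
  have h := lift_rank_eq_of_equiv_equiv i j.toAddEquiv i.bijective fun r x => j.map_smulₛₗ r x
  have h2 := congrArg Cardinal.toNat h
  rw [Cardinal.toNat_lift, Cardinal.toNat_lift] at h2
  change finrank B _ = finrank (pPowers p E) _ at h2
  rw [h2, hmap]

end BaseChange

/-! ### The `p`-th powers of F(b₁^{1/p}, …, b_r^{1/p}) -/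

section RootField

open IntermediateField

variable {p : ℕ} [Fact p.Prime] {F : Type*} [Field F] [CharP F p]

/-- Frobenius is a ring homomorphism, so it suffices to look at generators. With the converse below,
the `p`-th powers of the root field are exactly `F ^ p (b₁, …, b_r)`. -/
theorem exists_pow_eq_of_mem_pthRootField {r : ℕ} (b : Fin r → F) (x : pthRootField p b) :
    ∃ c ∈ adjoin (pPowers p F) (Set.range b),
      x ^ p = algebraMap F (pthRootField p b) c := by
  have hp : p.Prime := Fact.out
  have : CharP (AlgebraicClosure F) p :=
    charP_of_injective_algebraMap (algebraMap F (AlgebraicClosure F)).injective p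
  suffices h : ∀ y ∈ pthRootField p b, ∃ c ∈ adjoin (pPowers p F) (Set.range b),
      y ^ p = algebraMap F (AlgebraicClosure F) c by
    obtain ⟨c, hc, hxc⟩ := h x x.2
    exact ⟨c, hc, Subtype.ext hxc⟩
  intro y hy
  induction hy using adjoin_induction with
  | mem y hy =>
    obtain ⟨i, hi⟩ := hy
    exact ⟨b i, subset_adjoin _ _ ⟨i, rfl⟩, hi⟩
  | algebraMap a =>
    exact ⟨a ^ p, IntermediateField.algebraMap_mem _ (⟨a ^ p, a, rfl⟩ : pPowers p F), (RingHom.map_pow _ _ _).symm⟩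
  | add y z _ _ hy hz =>
    obtain ⟨c, hc, hy⟩ := hy
    obtain ⟨d, hd, hz⟩ := hz
    exact ⟨c + d, add_mem hc hd, by rw [add_pow_char, hy, hz, RingHom.map_add]⟩
  | inv y _ hy =>
    obtain ⟨c, hc, hy⟩ := hy
    exact ⟨c⁻¹, inv_mem hc, by rw [inv_pow, hy, map_inv₀]⟩
  | mul y z _ _ hy hz =>
    obtain ⟨c, hc, hy⟩ := hy
    obtain ⟨d, hd, hz⟩ := hz
    exact ⟨c * d, mul_mem hc hd, by rw [mul_pow, hy, hz, RingHom.map_mul]⟩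

theorem exists_mem_pthRootField_pow_eq {r : ℕ} (b : Fin r → F) {c : F}
    (hc : c ∈ adjoin (pPowers p F) (Set.range b)) :
    ∃ x : pthRootField p b, x ^ p = algebraMap F (pthRootField p b) c := by
  have hp : p.Prime := Fact.out
  have : CharP (AlgebraicClosure F) p :=
    charP_of_injective_algebraMap (algebraMap F (AlgebraicClosure F)).injective p
  suffices h : ∃ y ∈ pthRootField p b, y ^ p = algebraMap F (AlgebraicClosure F) c by
    obtain ⟨y, hy, hyc⟩ := h
    exact ⟨⟨y, hy⟩, Subtype.ext hyc⟩
  induction hc using adjoin_induction with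
  | mem c hc =>
    obtain ⟨i, rfl⟩ := hc
    obtain ⟨y, hy⟩ := IsAlgClosed.exists_pow_nat_eq (algebraMap F (AlgebraicClosure F) (b i)) hp.pos
    exact ⟨y, subset_adjoin _ _ ⟨i, hy⟩, hy⟩
  | algebraMap a =>
    obtain ⟨_, a, rfl⟩ := a
    exact ⟨algebraMap F _ a, IntermediateField.algebraMap_mem _ a, (RingHom.map_pow _ _ _).symm⟩
  | add c d _ _ hc hd =>
    obtain ⟨y, hy, hc⟩ := hc
    obtain ⟨z, hz, hd⟩ := hd
    exact ⟨y + z, add_mem hy hz, by rw [add_pow_char, hc, hd, RingHom.map_add]⟩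
  | inv c _ hc =>
    obtain ⟨y, hy, hc⟩ := hc
    exact ⟨y⁻¹, inv_mem hy, by rw [inv_pow, hc, map_inv₀]⟩
  | mul c d _ _ hc hd =>
    obtain ⟨y, hy, hc⟩ := hc
    obtain ⟨z, hz, hd⟩ := hd
    exact ⟨y * z, mul_mem hy hz, by rw [mul_pow, hc, hd, RingHom.map_mul]⟩

theorem pow_mem_range_of_pthRootField {r : ℕ} (b : Fin r → F) (x : pthRootField p b) :
    x ^ p ∈ (algebraMap F (pthRootField p b)).range := by
  obtain ⟨c, -, hc⟩ := exists_pow_eq_of_mem_pthRootField b x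
  exact ⟨c, hc.symm⟩

theorem isPurelyInseparable_pthRootField {r : ℕ} (b : Fin r → F) :
    IsPurelyInseparable F (pthRootField p b) := by
  have : ExpChar F p := ExpChar.prime Fact.out
  rw [isPurelyInseparable_iff_pow_mem F p]
  exact fun x => ⟨1, by simpa using pow_mem_range_of_pthRootField b x⟩

variable {V : Type*} [AddCommGroup V] [Module F V] [FiniteDimensional F V]

theorem anisotropicDimOver_pthRootField_iff (φ : PForm p F V) {r : ℕ} (b : Fin r → F) (m : ℕ) :
    φ.AnisotropicDimOver (pthRootField p b) m ↔
      Module.finrank (adjoin (pPowers p F) (Set.range b))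
        (Submodule.span (adjoin (pPowers p F) (Set.range b)) (φ.valueSpace : Set F)) = m :=
  φ.anisotropicDimOver_iff_of_subfield _ _ (fun _ hc => exists_mem_pthRootField_pow_eq b hc)
    (exists_pow_eq_of_mem_pthRootField b) m

theorem mem_fullSplittingPattern_of_pthRootField {F : Type u} [Field F] [CharP F p] {V : Type w}
    [AddCommGroup V] [Module F V] [FiniteDimensional F V] {φ : PForm p F V} {r : ℕ}
    {b : Fin r → F} {m : ℕ} (h : φ.AnisotropicDimOver (pthRootField p b) m) :
    m ∈ fullSplittingPattern.{u, v} φ := by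
  rw [anisotropicDimOver_pthRootField_iff] at h
  -- The root field lives in the universe of `F` and has to be lifted to the one over which the
  -- pattern ranges.
  let e : ULift.{v} (pthRootField p b) ≃ₐ[F] pthRootField p b := ULift.algEquiv
  refine ⟨ULift.{v} (pthRootField p b), inferInstance, inferInstance,
    (φ.anisotropicDimOver_iff_of_subfield _ _ (fun c hc => ?_) (fun x => ?_) m).2 h⟩
  · obtain ⟨x, hx⟩ := exists_mem_pthRootField_pow_eq b hc
    exact ⟨e.symm x, by rw [← _root_.map_pow, hx, AlgEquiv.commutes]⟩
  · obtain ⟨c, hc, hx⟩ := exists_pow_eq_of_mem_pthRootField b (e x)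
    exact ⟨c, hc, e.injective (by rw [_root_.map_pow, hx, AlgEquiv.commutes])⟩

end RootField

/-! ### The span of P + dS: two cases -/

section Spans

open Module IntermediateField

variable {p : ℕ} [Fact p.Prime] {k F Q L : Type*} [Field k] [Field F] [Algebra k F]
  [Field Q] [Field L] [Algebra Q L]

theorem adjoin_image_adjoin (f : F →+* L)
    (hf : ∀ x : k, f (algebraMap k F x) ∈ (algebraMap Q L).range) (s : Set F) :
    adjoin Q (f '' (adjoin k s : Set F)) = adjoin Q (f '' s) := by
  refine le_antisymm (adjoin_le_iff.2 ?_)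
    (adjoin.mono Q _ _ (Set.image_mono (subset_adjoin k s)))
  rintro _ ⟨x, hx, rfl⟩
  change f x ∈ adjoin Q (f '' s)
  replace hx : x ∈ adjoin k s := hx
  induction hx using adjoin_induction with
  | mem x hx => exact subset_adjoin _ _ ⟨x, hx, rfl⟩
  | algebraMap x =>
    obtain ⟨y, hy⟩ := hf x
    exact hy ▸ IntermediateField.algebraMap_mem _ y
  | add x y _ _ hx hy => rw [RingHom.map_add]; exact add_mem hx hy
  | inv x _ hx => rw [map_inv₀]; exact inv_mem hx
  | mul x y _ _ hx hy => rw [RingHom.map_mul]; exact mul_mem hx hy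

theorem adjoin_span (s : Set F) : adjoin k (Submodule.span k s : Set F) = adjoin k s := by
  refine le_antisymm (adjoin_le_iff.2 ?_) (adjoin.mono k _ _ Submodule.subset_span)
  have : Submodule.span k s ≤ (adjoin k s).toSubalgebra.toSubmodule :=
    Submodule.span_le.2 (subset_adjoin k s)
  exact this

/-- The sum is direct: if `e * y ∈ P` with `0 ≠ y ∈ S ⊆ P`, dividing by `y` would give `e ∈ P`. -/
theorem finrank_sup_mul (P : IntermediateField Q L) {S : Submodule Q L}
    (hS : S ≤ P.toSubalgebra.toSubmodule) [FiniteDimensional Q P] {e : L} (he : e ∉ P) :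
    finrank Q ↥(P.toSubalgebra.toSubmodule ⊔ S.map (LinearMap.mulLeft Q e)) =
      finrank Q P + finrank Q S := by
  have he0 : e ≠ 0 := by rintro rfl; exact he (zero_mem P)
  have : FiniteDimensional Q P.toSubalgebra.toSubmodule := ‹FiniteDimensional Q P›
  have : FiniteDimensional Q S := Submodule.finiteDimensional_of_le hS
  have h1 := Submodule.finrank_sup_add_finrank_inf_eq P.toSubalgebra.toSubmodule
    (S.map (LinearMap.mulLeft Q e))
  have h2 : P.toSubalgebra.toSubmodule ⊓ S.map (LinearMap.mulLeft Q e) = ⊥ := by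
    rw [eq_bot_iff]
    rintro _ ⟨hx, y, hy, rfl⟩
    change e * y ∈ P at hx
    by_contra hne
    have hy0 : y ≠ 0 := by rintro rfl; exact hne (by simp)
    have hyP : y ∈ P := hS hy
    exact he (by simpa [hy0] using mul_mem hx (inv_mem hyP))
  have h3 : finrank Q ↥(S.map (LinearMap.mulLeft Q e)) = finrank Q S :=
    (Submodule.equivMapOfInjective (LinearMap.mulLeft Q e) (mul_right_injective₀ he0)
      S).finrank_eq.symm
  rw [h2, finrank_bot, add_zero, h3] at h1
  exact h1

/-- The image of `P` is closed under multiplication, so in exponent one its `Q`-span is already a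
field. -/
theorem span_image_eq_sup [CharP L p] (h : ∀ x : L, x ^ p ∈ (algebraMap Q L).range) (f : F →+* L)
    (P : IntermediateField k F) (S D : Submodule k F) (d : F)
    (hD : ∀ x, x ∈ D ↔ ∃ a ∈ P, ∃ b ∈ S, x = a + d * b) :
    Submodule.span Q (f '' (D : Set F)) =
      (adjoin Q (f '' (P : Set F))).toSubalgebra.toSubmodule ⊔
        (Submodule.span Q (f '' (S : Set F))).map (LinearMap.mulLeft Q (f d)) := by
  have hP : Submodule.span Q (f '' (P : Set F)) =
      (adjoin Q (f '' (P : Set F))).toSubalgebra.toSubmodule :=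
    span_eq_adjoin h (P.toSubfield.toSubring.toSubmonoid.map (f : F →* L))
  rw [← hP, Submodule.map_span]
  refine le_antisymm (Submodule.span_le.2 ?_) (sup_le ?_ ?_)
  · rintro _ ⟨x, hx, rfl⟩
    obtain ⟨a, ha, b, hb, rfl⟩ := (hD x).1 hx
    rw [RingHom.map_add, RingHom.map_mul]
    exact Submodule.add_mem_sup (Submodule.subset_span ⟨a, ha, rfl⟩)
      (Submodule.subset_span ⟨f b, ⟨b, hb, rfl⟩, rfl⟩)
  · refine Submodule.span_mono (Set.image_mono fun a ha => ?_)
    exact (hD a).2 ⟨a, ha, 0, zero_mem S, by simp⟩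
  · refine Submodule.span_mono ?_
    rintro _ ⟨_, ⟨b, hb, rfl⟩, rfl⟩
    exact ⟨d * b, (hD _).2 ⟨0, zero_mem P, b, hb, by simp⟩, RingHom.map_mul _ _ _⟩

theorem span_image_le_adjoin (f : F →+* L) {P : IntermediateField k F} {S : Submodule k F}
    (hS : S ≤ P.toSubalgebra.toSubmodule) :
    Submodule.span Q (f '' (S : Set F)) ≤
      (adjoin Q (f '' (P : Set F))).toSubalgebra.toSubmodule :=
  Submodule.span_le.2 ((Set.image_mono hS).trans (subset_adjoin Q _))

theorem finrank_span_image_of_mem [CharP L p] (h : ∀ x : L, x ^ p ∈ (algebraMap Q L).range)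
    (f : F →+* L) (P : IntermediateField k F) {S D : Submodule k F} {d : F}
    (hD : ∀ x, x ∈ D ↔ ∃ a ∈ P, ∃ b ∈ S, x = a + d * b) (hS : S ≤ P.toSubalgebra.toSubmodule)
    (hd : f d ∈ adjoin Q (f '' (P : Set F))) :
    finrank Q (Submodule.span Q (f '' (D : Set F))) = finrank Q (adjoin Q (f '' (P : Set F))) := by
  rw [span_image_eq_sup h f P S D d hD, sup_eq_left.2]
  · rfl
  · rintro _ ⟨x, hx, rfl⟩
    exact (adjoin Q (f '' (P : Set F))).mul_mem hd (span_image_le_adjoin f hS hx)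

theorem finrank_span_image_of_notMem [CharP L p] (h : ∀ x : L, x ^ p ∈ (algebraMap Q L).range)
    (f : F →+* L) (P : IntermediateField k F) {S D : Submodule k F} {d : F}
    (hD : ∀ x, x ∈ D ↔ ∃ a ∈ P, ∃ b ∈ S, x = a + d * b) (hS : S ≤ P.toSubalgebra.toSubmodule)
    [FiniteDimensional Q (adjoin Q (f '' (P : Set F)))]
    (hd : f d ∉ adjoin Q (f '' (P : Set F))) :
    finrank Q (Submodule.span Q (f '' (D : Set F))) =
      finrank Q (adjoin Q (f '' (P : Set F))) + finrank Q (Submodule.span Q (f '' (S : Set F))) := by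
  rw [span_image_eq_sup h f P S D d hD, finrank_sup_mul _ (span_image_le_adjoin f hS) hd]

end Spans

/-! ### Necessity of the bounds -/

section Forward

open Module IntermediateField

variable {p : ℕ} [Fact p.Prime] {k F Q L : Type*} [Field k] [Field F] [Algebra k F] [CharP F p]
  [Field Q] [Field L] [Algebra Q L] [CharP L p]

/-- The dimensions that can occur after an extension of the base. -/
theorem exists_finrank_span_image_eq (hk : ∀ x : F, x ^ p ∈ (algebraMap k F).range)
    (h : ∀ x : L, x ^ p ∈ (algebraMap Q L).range) (f : F →+* L)
    (hf : ∀ x : k, f (algebraMap k F x) ∈ (algebraMap Q L).range)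
    {n s : ℕ} (P : IntermediateField k F) (hP : finrank k P = p ^ n) {S D : Submodule k F} {d : F}
    (hD : ∀ x, x ∈ D ↔ ∃ a ∈ P, ∃ b ∈ S, x = a + d * b) (hS : S ≤ P.toSubalgebra.toSubmodule)
    (h1 : (1 : F) ∈ S) (hs : finrank k S = s)
    (hN : p * finrank k (adjoin k (S : Set F)) = p ^ s) :
    ∃ j l : ℕ, finrank Q (Submodule.span Q (f '' (D : Set F))) = p ^ j + l ∧ j ≤ n ∧
      (l = 0 ∨ 1 ≤ l ∧ j + s ≤ l + n ∧ l ≤ s ∧ l ≤ p ^ j) := by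
  have hp : p.Prime := Fact.out
  have hPfd : FiniteDimensional k P := Module.finite_of_finrank_pos (by rw [hP]; exact pow_pos hp.pos n)
  have hPfd' : FiniteDimensional k P.toSubalgebra.toSubmodule := hPfd
  have hSfd : FiniteDimensional k S := Submodule.finiteDimensional_of_le hS
  have hs0 : 1 ≤ s := by
    have := Submodule.finrank_mono ((Submodule.span_singleton_le_iff_mem (R := k) _ _).2 h1)
    rwa [finrank_span_singleton one_ne_zero, hs] at this
  -- From here on `s` is dim S - 1, so that `[N : k] = p ^ s`.
  obtain ⟨s, rfl⟩ : ∃ s', s = s' + 1 := ⟨s - 1, by omega⟩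
  rw [pow_succ', Nat.mul_right_inj hp.ne_zero] at hN
  set N := adjoin k (S : Set F)
  have hNP : N ≤ P := adjoin_le_iff.2 hS
  have hsn : s ≤ n := by
    have : finrank k N ≤ finrank k P :=
      Submodule.finrank_mono (s := N.toSubalgebra.toSubmodule) (t := P.toSubalgebra.toSubmodule) hNP
    rw [hN, hP] at this
    exact (Nat.pow_le_pow_iff_right hp.one_lt).1 this
  obtain ⟨a, ha⟩ := exists_eq_sup_adjoin (ι := Fin n) hk (M := ⊥) (P := P) bot_le (by simp)
    (by rw [IntermediateField.finrank_bot, hP]; simp)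
  obtain ⟨z, hz⟩ := exists_eq_sup_adjoin (ι := Fin (n - s)) hk hNP
    (by rw [hN]; exact pow_ne_zero _ hp.ne_zero)
    (by rw [hN, hP, Fintype.card_fin, ← pow_add]; congr 1; omega)
  rw [bot_sup_eq] at ha
  set PE := adjoin Q (f '' (P : Set F)) with hPE
  have hPE1 : PE = adjoin Q (Set.range (f ∘ a)) := by
    rw [hPE, ha, adjoin_image_adjoin f hf, Set.range_comp]
  obtain ⟨j, hj, hjfr⟩ := exists_finrank_adjoin h (f ∘ a)
  rw [← hPE1] at hjfr
  rw [Fintype.card_fin] at hj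
  have hPEfd : FiniteDimensional Q PE :=
    Module.finite_of_finrank_pos (by rw [hjfr]; exact pow_pos hp.pos j)
  have hPEfd' : FiniteDimensional Q PE.toSubalgebra.toSubmodule := hPEfd
  by_cases hd : f d ∈ PE
  · exact ⟨j, 0, by rw [finrank_span_image_of_mem h f P hD hS hd, hjfr, add_zero], hj, Or.inl rfl⟩
  have hSPE := span_image_le_adjoin (Q := Q) f hS
  have hSEfd : FiniteDimensional Q (Submodule.span Q (f '' (S : Set F))) :=
    Submodule.finiteDimensional_of_le hSPE
  refine ⟨j, finrank Q (Submodule.span Q (f '' (S : Set F))),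
    by rw [finrank_span_image_of_notMem h f P hD hS hd, hjfr], hj, Or.inr ?_⟩
  obtain ⟨c, hc, hcfr⟩ := exists_finrank_adjoin_submodule h
    (Submodule.span Q (f '' (S : Set F))) (Submodule.subset_span ⟨1, h1, f.map_one⟩)
  rw [adjoin_span] at hcfr
  obtain ⟨c', hc', hcfr'⟩ := exists_finrank_sup_adjoin h (adjoin Q (f '' (S : Set F))) (f ∘ z)
  have hPE2 : PE = adjoin Q (f '' (S : Set F)) ⊔ adjoin Q (Set.range (f ∘ z)) := by
    rw [hPE, hz, ← adjoin_union, adjoin_image_adjoin f hf, Set.image_union, adjoin_union,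
      Set.range_comp]
  -- Now `j = c' + c`, where `c' ≤ n - s` counts generators of `P` over `N` and `c ≤ l - 1` those of
  -- the field spanned by `S`: the lower bound on `l`.
  rw [← hPE2, hjfr, hcfr, ← pow_add, Nat.pow_right_inj hp.one_lt] at hcfr'
  rw [Fintype.card_fin] at hc'
  refine ⟨by omega, by omega, ?_, ?_⟩
  -- The images of a `k`-basis of `S` span over `Q`, because `f` maps `k` into `Q`.
  · let b := finBasisOfFinrankEq k S hs
    have hle : Submodule.span Q (f '' (S : Set F)) ≤
        Submodule.span Q (Set.range fun i => f (b i)) := by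
      refine Submodule.span_le.2 ?_
      rintro _ ⟨x, hx, rfl⟩
      have hx' : x = ∑ i, b.repr ⟨x, hx⟩ i • (b i : F) := by
        conv_lhs => rw [show x = ((⟨x, hx⟩ : S) : F) from rfl, ← b.sum_repr ⟨x, hx⟩]
        rw [AddSubmonoidClass.coe_finsetSum]
        rfl
      rw [SetLike.mem_coe, hx', _root_.map_sum]
      refine Submodule.sum_mem _ fun i _ => ?_
      obtain ⟨y, hy⟩ := hf (b.repr ⟨x, hx⟩ i)
      rw [Algebra.smul_def, RingHom.map_mul, ← hy, ← Algebra.smul_def]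
      exact Submodule.smul_mem _ _ (Submodule.subset_span ⟨i, rfl⟩)
    have : FiniteDimensional Q (Submodule.span Q (Set.range fun i => f (b i))) :=
      FiniteDimensional.span_of_finite Q (Set.finite_range _)
    have := finrank_range_le_card (R := Q) fun i => f (b i)
    rw [Fintype.card_fin] at this
    exact (Submodule.finrank_mono hle).trans this
  · rw [← hjfr]
    exact Submodule.finrank_mono hSPE

end Forward

/-! ### Subfields with prescribed degrees and spans -/

section Construction

open Module IntermediateField

variable {p : ℕ} [Fact p.Prime] {k L : Type*} [Field k] [Field L] [Algebra k L]

theorem finrank_mul_finrank_adjoin (B P : IntermediateField k L) :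
    finrank k B * finrank B (adjoin B (P : Set L)) = finrank k ↥(B ⊔ P) := by
  have h := restrictScalars_adjoin_eq_sup k B (P : Set L)
  rw [adjoin_self] at h
  rw [← h]
  exact finrank_mul_finrank k B (adjoin B (P : Set L))

theorem range_eq_union_of_sum {α β γ : Type*} (u : α ⊕ β → γ) :
    Set.range u = Set.range (u ∘ Sum.inl) ∪ Set.range (u ∘ Sum.inr) := by
  ext x
  simp

theorem exists_fin_range_eq {ι α : Type*} [Fintype ι] (u : ι → α) :
    ∃ (r : ℕ) (b : Fin r → α), Set.range b = Set.range u :=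
  ⟨Fintype.card ι, u ∘ (Fintype.equivFin ι).symm, (Fintype.equivFin ι).symm.surjective.range_comp u⟩

/-- Over a linearly disjoint field the dimension of a space does not change. -/
theorem finrank_span_of_linearDisjoint {J B : IntermediateField k L} (hJB : J.LinearDisjoint B)
    {W : Submodule k L} [FiniteDimensional k W] (hW : W ≤ J.toSubalgebra.toSubmodule) :
    finrank B (Submodule.span B (W : Set L)) = finrank k W := by
  let w := finBasis k W
  let a : Fin (finrank k W) → J := fun i => ⟨w i, hW (w i).2⟩
  have h0 : LinearIndependent k fun i => (w i : L) :=
    w.linearIndependent.map' W.subtype W.ker_subtype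
  have h1 : LinearIndependent k a := LinearIndependent.of_comp J.val.toLinearMap h0
  have h2 : LinearIndependent B (J.val ∘ a) := hJB.linearIndependent_left h1
  replace h2 : LinearIndependent B fun i => (w i : L) := h2
  have h3 : Submodule.span B (W : Set L) = Submodule.span B (Set.range fun i => (w i : L)) := by
    refine le_antisymm (Submodule.span_le.2 fun x hx => ?_) (Submodule.span_mono ?_)
    · rw [show x = ((⟨x, hx⟩ : W) : L) from rfl, ← w.sum_repr ⟨x, hx⟩,
        AddSubmonoidClass.coe_finsetSum]
      refine Submodule.sum_mem _ fun i _ => ?_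
      rw [Submodule.coe_smul, ← algebraMap_smul B]
      exact Submodule.smul_mem _ _ (Submodule.subset_span ⟨i, rfl⟩)
    · rintro _ ⟨i, rfl⟩
      exact (w i).2
  rw [h3, finrank_span_eq_card h2, Fintype.card_fin]

variable [CharP L p]

/-- Take `B` generated by `d` and `q` of `j + q` generators of `P`. Then `P(d)` has degree `p ^ (j +
q + 1)`, while `B` has at most `q + 1` generators and `P(d)` at most `j` over `B`; both counts must
be sharp. -/
theorem exists_adjoin_mem (h : ∀ x : L, x ^ p ∈ (algebraMap k L).range)
    {P : IntermediateField k L} {j q : ℕ} (hP : finrank k P = p ^ (j + q)) {d : L} (hd : d ∉ P) :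
    ∃ (r : ℕ) (b : Fin r → L), d ∈ adjoin k (Set.range b) ∧
      finrank (adjoin k (Set.range b)) (adjoin (adjoin k (Set.range b)) (P : Set L)) = p ^ j := by
  have hp : p.Prime := Fact.out
  obtain ⟨a, ha⟩ := exists_eq_sup_adjoin (ι := Fin j ⊕ Fin q) h (M := ⊥) (P := P) bot_le (by simp)
    (by rw [IntermediateField.finrank_bot, hP]; simp)
  obtain ⟨r, b, hb⟩ := exists_fin_range_eq (Sum.elim (fun _ : Fin 1 => d) (a ∘ Sum.inr))
  obtain ⟨c₁, hc₁, hB⟩ := exists_finrank_adjoin h (Sum.elim (fun _ : Fin 1 => d) (a ∘ Sum.inr))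
  rw [bot_sup_eq, range_eq_union_of_sum, adjoin_union] at ha
  refine ⟨r, b, subset_adjoin _ _ (hb ▸ ⟨Sum.inl 0, rfl⟩), ?_⟩
  rw [← hb] at hB
  have hB' : adjoin k (Set.range b) = k⟮d⟯ ⊔ adjoin k (Set.range (a ∘ Sum.inr)) := by
    rw [hb, range_eq_union_of_sum, adjoin_union, Sum.elim_comp_inl, Sum.elim_comp_inr,
      Set.range_const]
  obtain ⟨c₂, hc₂, hBP⟩ :=
    exists_finrank_sup_adjoin h (adjoin k (Set.range b)) (a ∘ Sum.inl)
  have h1 : adjoin k (Set.range b) ⊔ adjoin k (Set.range (a ∘ Sum.inl)) = P ⊔ k⟮d⟯ := by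
    rw [hB', ha, sup_assoc, sup_comm k⟮d⟯, sup_comm (adjoin k (Set.range (a ∘ Sum.inr))) (adjoin _ _)]
  have h2 : adjoin k (Set.range b) ⊔ P = P ⊔ k⟮d⟯ := by
    rw [← h1]
    refine le_antisymm (sup_le le_sup_left ?_) (sup_le le_sup_left ?_)
    · rw [h1]; exact le_sup_left
    · exact (le_sup_left.trans ha.ge).trans le_sup_right
  have h3 := finrank_mul_finrank_adjoin (adjoin k (Set.range b)) P
  rw [h1, finrank_sup_adjoin_simple h P hd, hP, hB, ← pow_succ', ← pow_add,
    Nat.pow_right_inj hp.one_lt] at hBP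
  rw [h2, finrank_sup_adjoin_simple h P hd, hP, hB, ← pow_succ'] at h3
  simp only [Fintype.card_sum, Fintype.card_fin] at hc₁ hc₂
  have h4 : j + q + 1 = c₁ + j := by omega
  rw [h4, pow_add] at h3
  exact Nat.eq_of_mul_eq_mul_left (pow_pos hp.pos _) h3

/-- A subfield `B` of `P` of prescribed degree such that the `B`-span of `S` has prescribed
dimension. The parameters are `j + e = log [P : B]`, `j + q + 1 = dim_B B S`,
`j + q + r + 1 = dim S` and `[P : k] = p ^ (j + q + r + e + g)`. -/
theorem exists_adjoin_finrank_span (h : ∀ x : L, x ^ p ∈ (algebraMap k L).range)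
    {P : IntermediateField k L} {S : Submodule k L} (hS : S ≤ P.toSubalgebra.toSubmodule)
    (h1 : (1 : L) ∈ S) {j q r e g : ℕ} (hP : finrank k P = p ^ (j + q + r + e + g))
    (hSfr : finrank k S = j + q + r + 1)
    (hN : finrank k (adjoin k (S : Set L)) = p ^ (j + q + r)) (hl : j + q + 1 ≤ p ^ j) :
    ∃ (t : ℕ) (b : Fin t → L), adjoin k (Set.range b) ≤ P ∧
      finrank (adjoin k (Set.range b)) (adjoin (adjoin k (Set.range b)) (P : Set L)) =
        p ^ (j + e) ∧
      finrank (adjoin k (Set.range b)) (Submodule.span (adjoin k (Set.range b)) (S : Set L)) =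
        j + q + 1 := by
  have hp : p.Prime := Fact.out
  have hPfd : FiniteDimensional k P :=
    Module.finite_of_finrank_pos (by rw [hP]; exact pow_pos hp.pos _)
  have hSfd : FiniteDimensional k S := Module.finite_of_finrank_pos (by omega)
  have hNP : adjoin k (S : Set L) ≤ P := adjoin_le_iff.2 hS
  -- generators
  have hle1 : (k ∙ (1 : L)) ≤ S := (Submodule.span_singleton_le_iff_mem _ _).2 h1
  have hfr1 : finrank k (k ∙ (1 : L)) = 1 := finrank_span_singleton one_ne_zero
  -- Roles of the blocks: `j` elements of `S` stay free over `B`, `q` become congruent to elements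
  -- of `W` modulo `B`, `r` fall into `B`. Of the generators `z` of `P` over `k(S)`, `e` stay free
  -- and `g` fall into `B`.
  obtain ⟨x, hx⟩ := exists_eq_sup_span (ι := Fin j ⊕ (Fin q ⊕ Fin r)) hle1
    (by rw [hSfr, hfr1]; simp; omega)
  obtain ⟨z, hz⟩ := exists_eq_sup_adjoin (ι := Fin e ⊕ Fin g) h hNP
    (by rw [hN]; exact pow_ne_zero _ hp.ne_zero)
    (by rw [hN, hP, ← pow_add]; congr 1; simp; omega)
  rw [adjoin_eq_of_eq_sup_span hx] at hz hN
  set xf := x ∘ Sum.inl with hxf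
  set xr := x ∘ Sum.inr with hxr
  have hxrange : Set.range x = Set.range xf ∪ Set.range xr := range_eq_union_of_sum x
  -- the field of the free part
  set J := adjoin k (Set.range xf) with hJ
  obtain ⟨c₁, hc₁, hJfr⟩ := exists_finrank_adjoin h xf
  obtain ⟨c₂, hc₂, hNfr⟩ := exists_finrank_sup_adjoin h J xr
  rw [← adjoin_union, ← hxrange, hN, hJfr, ← pow_add, Nat.pow_right_inj hp.one_lt] at hNfr
  simp only [Fintype.card_sum, Fintype.card_fin] at hc₁ hc₂
  -- `c₁ ≤ j`, `c₂ ≤ q + r` and `c₁ + c₂ = j + q + r` force equality.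
  have hcj : c₁ = j := by omega
  rw [hcj] at hJfr
  have hJfd : FiniteDimensional k J :=
    Module.finite_of_finrank_pos (by rw [hJfr]; exact pow_pos hp.pos _)
  have hJfd' : FiniteDimensional k J.toSubalgebra.toSubmodule := hJfd
  -- the space inside it
  set W₀ := (k ∙ (1 : L)) ⊔ Submodule.span k (Set.range xf) with hW₀
  have hW₀J : W₀ ≤ J.toSubalgebra.toSubmodule :=
    sup_le ((Submodule.span_singleton_le_iff_mem _ _).2 (one_mem J))
      (Submodule.span_le.2 (subset_adjoin k _))
  have hW₀fr : finrank k W₀ = j + 1 := by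
    have hxf' : FiniteDimensional k (Submodule.span k (Set.range xf)) :=
      FiniteDimensional.span_of_finite k (Set.finite_range _)
    have hxr' : FiniteDimensional k (Submodule.span k (Set.range xr)) :=
      FiniteDimensional.span_of_finite k (Set.finite_range _)
    have a1 := Submodule.finrank_add_le_finrank_add_finrank (k ∙ (1 : L))
      (Submodule.span k (Set.range xf))
    have a2 := Submodule.finrank_add_le_finrank_add_finrank W₀ (Submodule.span k (Set.range xr))
    have a3 : W₀ ⊔ Submodule.span k (Set.range xr) = S := by
      rw [hx, hxrange, Submodule.span_union, sup_assoc]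
    have a4 := finrank_range_le_card (R := k) xf
    have a5 := finrank_range_le_card (R := k) xr
    rw [Set.finrank] at a4 a5
    simp only [Fintype.card_sum, Fintype.card_fin] at a4 a5
    rw [← hW₀, hfr1] at a1
    rw [a3, hSfr] at a2
    omega
  -- There is room for `W` inside `J` because `j + q + 1 ≤ p ^ j = [J : k]`.
  obtain ⟨W, hW₀W, hWJ, hWfr⟩ := exists_between_finrank (l := j + q + 1) hW₀J (by omega)
    (hl.trans hJfr.ge)
  have hWfd : FiniteDimensional k W := Submodule.finiteDimensional_of_le hWJ
  obtain ⟨m, hm⟩ := exists_eq_sup_span (ι := Fin q) hW₀W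
    (by rw [hWfr, hW₀fr, Fintype.card_fin]; omega)
  have hmW : ∀ i, m i ∈ W := fun i => by
    rw [hm]; exact Submodule.mem_sup_right (Submodule.subset_span ⟨i, rfl⟩)
  -- the subfield
  set y : (Fin q ⊕ Fin r) ⊕ Fin g → L :=
    Sum.elim (Sum.elim (fun i => xr (Sum.inl i) - m i) (xr ∘ Sum.inr)) (z ∘ Sum.inr) with hy
  obtain ⟨t, b, hb⟩ := exists_fin_range_eq y
  refine ⟨t, b, ?_⟩
  obtain ⟨c₃, hc₃, hBfr⟩ := exists_finrank_adjoin h y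
  simp only [Fintype.card_sum, Fintype.card_fin] at hc₃
  rw [hb]
  set B := adjoin k (Set.range y) with hB
  have hyB : ∀ i, y i ∈ B := fun i => subset_adjoin _ _ ⟨i, rfl⟩
  have hxP : ∀ i, x i ∈ P := fun i => by
    rw [hz]; exact (le_sup_left : _ ≤ _ ⊔ adjoin k (Set.range z)) (subset_adjoin _ _ ⟨i, rfl⟩)
  have hzP : ∀ i, z i ∈ P := fun i => by
    rw [hz]; exact (le_sup_right : _ ≤ adjoin k (Set.range x) ⊔ _) (subset_adjoin _ _ ⟨i, rfl⟩)
  have hJP : J ≤ P := adjoin_le_iff.2 (by rintro _ ⟨i, rfl⟩; exact hxP _)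
  have hBP : B ≤ P := by
    refine adjoin_le_iff.2 ?_
    rintro _ ⟨(i | i) | i, rfl⟩
    · exact sub_mem (hxP _) (hJP (hWJ (hmW i)))
    · exact hxP _
    · exact hzP _
  have hBfd : FiniteDimensional k B :=
    Module.finite_of_finrank_pos (by rw [hBfr]; exact pow_pos hp.pos _)
  -- degrees
  obtain ⟨c₄, hc₄, hBJfr⟩ := exists_finrank_sup_adjoin h B xf
  obtain ⟨c₅, hc₅, hBJzfr⟩ := exists_finrank_sup_adjoin h (B ⊔ J) (z ∘ Sum.inl)
  simp only [Fintype.card_fin] at hc₄ hc₅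
  have hBJz : B ⊔ J ⊔ adjoin k (Set.range (z ∘ Sum.inl)) = P := by
    refine le_antisymm (sup_le (sup_le hBP hJP) (adjoin_le_iff.2 ?_)) ?_
    · rintro _ ⟨i, rfl⟩; exact hzP _
    · set T := B ⊔ J ⊔ adjoin k (Set.range (z ∘ Sum.inl)) with hT
      have hBT : B ≤ T := le_sup_left.trans le_sup_left
      have hJT : J ≤ T := le_sup_right.trans le_sup_left
      rw [hz]
      refine sup_le (adjoin_le_iff.2 ?_) (adjoin_le_iff.2 ?_)
      · rintro _ ⟨i | i | i, rfl⟩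
        · exact hJT (subset_adjoin _ _ ⟨i, rfl⟩)
        · have := add_mem (hBT (hyB (Sum.inl (Sum.inl i)))) (hJT (hWJ (hmW i)))
          simpa [hy, hxr] using this
        · exact hBT (hyB (Sum.inl (Sum.inr i)))
      · rintro _ ⟨i | i, rfl⟩
        · exact (le_sup_right : _ ≤ T) (subset_adjoin _ _ ⟨i, rfl⟩)
        · exact hBT (hyB (Sum.inr i))
  rw [hBJz, hP, hBJfr, hBfr, ← pow_add, ← pow_add, Nat.pow_right_inj hp.one_lt] at hBJzfr
  -- The exponents `c₃ ≤ q + r + g`, `c₄ ≤ j`, `c₅ ≤ e` add up to that of `[P : k]`, so all three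
  -- bounds are attained.
  have hc3 : c₃ = q + r + g := by omega
  have hc4 : c₄ = j := by omega
  have hdisj : J.LinearDisjoint B := by
    refine LinearDisjoint.of_finrank_sup ?_
    rw [sup_comm, hBJfr, hJfr, hc4]
  refine ⟨hBP, ?_, ?_⟩
  · have h3 := finrank_mul_finrank_adjoin B P
    rw [sup_eq_right.2 hBP, hP, hBfr, hc3,
      show j + q + r + e + g = (q + r + g) + (j + e) by omega,
      pow_add p (q + r + g) (j + e)] at h3
    exact Nat.eq_of_mul_eq_mul_left (pow_pos hp.pos _) h3
  -- Both spaces contain 1, so elements of `B` are absorbed by either span; modulo `B`, the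
  -- `q`-block of `x` is `m` and the `r`-block vanishes.
  · have hspan : Submodule.span B (S : Set L) = Submodule.span B (W : Set L) := by
      have hmem1 : ∀ (V : Submodule k L) (c : L), (1 : L) ∈ V → c ∈ B →
          c ∈ Submodule.span B (V : Set L) := fun V c hV hc => by
        have := Submodule.smul_mem _ (⟨c, hc⟩ : B) (Submodule.subset_span (R := B) hV)
        rwa [Algebra.smul_def, mul_one] at this
      have h1W : (1 : L) ∈ W := hW₀W (Submodule.mem_sup_left (Submodule.mem_span_singleton_self _))
      have hxfW : ∀ i, xf i ∈ W := fun i =>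
        hW₀W (Submodule.mem_sup_right (Submodule.subset_span ⟨i, rfl⟩))
      have hxS : ∀ i, x i ∈ S := fun i => by
        rw [hx]; exact Submodule.mem_sup_right (Submodule.subset_span ⟨i, rfl⟩)
      refine le_antisymm (Submodule.span_le.2 ?_) (Submodule.span_le.2 ?_)
      · change S ≤ (Submodule.span B (W : Set L)).restrictScalars k
        rw [hx]
        refine sup_le ((Submodule.span_singleton_le_iff_mem _ _).2 (Submodule.subset_span h1W))
          (Submodule.span_le.2 ?_)
        rintro _ ⟨i | i | i, rfl⟩
        · exact Submodule.subset_span (hxfW i)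
        · have := add_mem (hmem1 W _ h1W (hyB (Sum.inl (Sum.inl i))))
            (Submodule.subset_span (hmW i))
          simpa [hy, hxr] using this
        · exact hmem1 W _ h1W (hyB (Sum.inl (Sum.inr i)))
      · change W ≤ (Submodule.span B (S : Set L)).restrictScalars k
        rw [hm]
        refine sup_le (sup_le ((Submodule.span_singleton_le_iff_mem _ _).2
          (Submodule.subset_span h1)) (Submodule.span_le.2 ?_)) (Submodule.span_le.2 ?_)
        · rintro _ ⟨i, rfl⟩
          exact Submodule.subset_span (hxS _)
        · rintro _ ⟨i, rfl⟩
          have := sub_mem (Submodule.subset_span (hxS (Sum.inr (Sum.inl i))))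
            (hmem1 S _ h1 (hyB (Sum.inl (Sum.inl i))))
          simpa [hy, hxr] using this
    rw [hspan, finrank_span_of_linearDisjoint hdisj hWJ, hWfr]

end Construction

/-! ### The values of π ⊥ dσ -/

section QuasiPfister

open Module IntermediateField

variable {p : ℕ} [Fact p.Prime] {F : Type*} [Field F] [CharP F p]
variable {V W U : Type*} [AddCommGroup V] [Module F V] [AddCommGroup W] [Module F W]
  [AddCommGroup U] [Module F U]

/-- The values of `⟨⟨a₁, …, aₙ⟩⟩` form the field `F ^ p (a₁, …, aₙ)`. -/
theorem valueSpace_diag_quasiPfisterCoeff {n : ℕ} (a : Fin n → F) :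
    (diag p (quasiPfisterCoeff p a)).valueSpace =
      (adjoin (pPowers p F) (Set.range a)).toSubalgebra.toSubmodule := by
  classical
  have hp : p.Prime := Fact.out
  refine le_antisymm ?_ ?_
  · rintro _ ⟨x, rfl⟩
    change ∑ e, quasiPfisterCoeff p a e * x e ^ p ∈ adjoin (pPowers p F) (Set.range a)
    refine sum_mem fun e _ => mul_mem (prod_mem fun i _ => pow_mem ?_ _) ?_
    · exact subset_adjoin _ _ ⟨i, rfl⟩
    · exact IntermediateField.algebraMap_mem _ (⟨x e ^ p, x e, rfl⟩ : pPowers p F)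
  · have := isAlgebraic_of_pow_mem (pow_mem_range_pPowers (p := p) (F := F))
    rw [adjoin_toSubalgebra_of_isAlgebraic fun x _ => Algebra.IsAlgebraic.isAlgebraic x,
      Algebra.adjoin_eq_span]
    refine Submodule.span_le.2 fun y hy => ?_
    obtain ⟨f, rfl⟩ := Submonoid.exists_of_mem_closure_range a y hy
    -- Divide each exponent of the monomial by `p`: the remainder selects the coefficient, the
    -- quotient goes into the `p`-th power.
    let e : Fin n → Fin p := fun i => ⟨f i % p, Nat.mod_lt _ hp.pos⟩
    refine ⟨Pi.single e (∏ i, a i ^ (f i / p)), ?_⟩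
    change ∑ e', quasiPfisterCoeff p a e' * (Pi.single e (∏ i, a i ^ (f i / p)) :
      (Fin n → Fin p) → F) e' ^ p = _
    rw [Finset.sum_eq_single e (fun e' _ he' => by
      rw [Pi.single_eq_of_ne he', zero_pow hp.ne_zero, mul_zero]) (by simp), Pi.single_eq_same,
      quasiPfisterCoeff, ← Finset.prod_pow, ← Finset.prod_mul_distrib]
    refine Finset.prod_congr rfl fun i _ => ?_
    rw [← pow_mul, ← pow_add, mul_comm (f i / p), Nat.mod_add_div]

theorem IsQuasiPfister.exists_valueSpace_eq {n : ℕ} {π : PForm p F V} (hπ : π.IsQuasiPfister n) :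
    finrank F V = p ^ n ∧ ∃ P : IntermediateField (pPowers p F) F,
      π.valueSpace = P.toSubalgebra.toSubmodule := by
  obtain ⟨a, ha⟩ := hπ
  refine ⟨?_, _, ha.valueSpace_eq.trans (valueSpace_diag_quasiPfisterCoeff a)⟩
  obtain ⟨f, -⟩ := ha
  rw [f.finrank_eq]
  simp

/-- For a nonzero value `c`, the norm field is generated by the values of `c⁻¹ σ`. -/
theorem normField_eq_adjoin (σ : PForm p F W) {w₀ : W} (h : σ w₀ ≠ 0) :
    σ.normField = adjoin (pPowers p F)
      (σ.valueSpace.map (LinearMap.mulLeft (pPowers p F) (σ w₀)⁻¹) : Set F) := by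
  refine le_antisymm (adjoin_le_iff.2 ?_) (adjoin_le_iff.2 ?_)
  · rintro _ ⟨v, w, hv, hw, rfl⟩
    have hmem : ∀ v, (σ w₀)⁻¹ * σ v ∈ adjoin (pPowers p F)
        (σ.valueSpace.map (LinearMap.mulLeft (pPowers p F) (σ w₀)⁻¹) : Set F) :=
      fun v => subset_adjoin _ _ ⟨_, ⟨v, rfl⟩, rfl⟩
    have := div_mem (hmem v) (hmem w)
    rwa [mul_div_mul_left _ _ (inv_ne_zero h)] at this
  · rintro _ ⟨_, ⟨v, rfl⟩, rfl⟩
    change (σ w₀)⁻¹ * σ v ∈ σ.normField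
    by_cases hv : σ v = 0
    · rw [hv, mul_zero]; exact zero_mem _
    · exact subset_adjoin _ _ ⟨v, w₀, hv, h, by rw [div_eq_mul_inv, mul_comm]⟩

variable [FiniteDimensional F V] [FiniteDimensional F W]

/-- The values of `π ⊥ d σ` in terms of a field `P` and a subspace `S` of `P` containing `1`. -/
theorem exists_valueSpace_decomposition {n : ℕ} {π : PForm p F V} (hπ : π.IsQuasiPfister n)
    {σ : PForm p F W} (hσ : σ.IsSubform π) (hmin : σ.IsMinimal) (hdim : 2 ≤ finrank F W)
    {d : F} {φ : PForm p F U} (hφ : φ.Isometric (π.orthSum (σ.scale d)))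
    (han : φ.Anisotropic) :
    ∃ (P : IntermediateField (pPowers p F) F) (S : Submodule (pPowers p F) F) (e : F),
      finrank (pPowers p F) P = p ^ n ∧ S ≤ P.toSubalgebra.toSubmodule ∧ (1 : F) ∈ S ∧
      finrank (pPowers p F) S = finrank F W ∧
      p * finrank (pPowers p F) (adjoin (pPowers p F) (S : Set F)) = p ^ finrank F W ∧
      finrank F W ≤ n + 1 ∧ e ∉ P ∧
      ∀ x, x ∈ φ.valueSpace ↔ ∃ a ∈ P, ∃ b ∈ S, x = a + e * b := by
  have hp : p.Prime := Fact.out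
  obtain ⟨hVn, P, hP⟩ := hπ.exists_valueSpace_eq
  obtain ⟨hσan, hdeg⟩ := hmin
  have hsum : ∀ v w, π v + d * σ w = 0 → v = 0 ∧ w = 0 := fun v w hvw => by
    obtain ⟨f, hf⟩ := hφ
    have h1 : φ (f.symm (v, w)) = 0 := by
      rw [hf, f.apply_symm_apply]
      exact hvw
    have h2 := (LinearEquiv.map_eq_zero_iff _).1 (han _ h1)
    exact Prod.mk_eq_zero.1 h2
  have hπan : π.Anisotropic := fun v hv => (hsum v 0 (by rw [hv, map_zero]; simp)).1
  have hPfr : finrank (pPowers p F) P = p ^ n := by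
    have := hπan.finrank_valueSpace
    rw [hP, hVn] at this
    exact this
  have hmemP : ∀ x, x ∈ P ↔ ∃ v, π v = x := fun x => by
    rw [← mem_valueSpace, hP]; rfl
  have hσP : ∀ w, σ w ∈ P := fun w => (hmemP _).2 (hσ.valueSpace_le ⟨w, rfl⟩)
  have : Nontrivial W := Module.nontrivial_of_finrank_pos (R := F) (by omega)
  obtain ⟨w₀, hw₀⟩ := exists_ne (0 : W)
  have hc : σ w₀ ≠ 0 := fun h => hw₀ (hσan _ h)
  -- Normalizing by a nonzero value puts 1 into `S`; the factor is returned in `e = d * σ w₀`.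
  set S := σ.valueSpace.map (LinearMap.mulLeft (pPowers p F) (σ w₀)⁻¹) with hSdef
  have hSP : S ≤ P.toSubalgebra.toSubmodule := by
    rintro _ ⟨_, ⟨w, rfl⟩, rfl⟩
    exact P.mul_mem (inv_mem (hσP w₀)) (hσP w)
  have hN : p * finrank (pPowers p F) (adjoin (pPowers p F) (S : Set F)) = p ^ finrank F W := by
    rw [hSdef, ← normField_eq_adjoin σ hc]
    exact hdeg
  have hPfd : FiniteDimensional (pPowers p F) P.toSubalgebra.toSubmodule :=
    Module.finite_of_finrank_pos (hPfr.symm ▸ pow_pos hp.pos n :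
      0 < finrank (pPowers p F) P)
  refine ⟨P, S, d * σ w₀, hPfr, hSP, ⟨σ w₀, ⟨w₀, rfl⟩, inv_mul_cancel₀ hc⟩, ?_, hN, ?_, ?_, ?_⟩
  · rw [← hσan.finrank_valueSpace]
    exact (Submodule.equivMapOfInjective (LinearMap.mulLeft (pPowers p F) (σ w₀)⁻¹)
      (mul_right_injective₀ (inv_ne_zero hc)) _).finrank_eq.symm
  · have h1 : finrank (pPowers p F) (adjoin (pPowers p F) (S : Set F)) ≤
        finrank (pPowers p F) P :=
      Submodule.finrank_mono (s := (adjoin (pPowers p F) (S : Set F)).toSubalgebra.toSubmodule)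
        (t := P.toSubalgebra.toSubmodule) (adjoin_le_iff.2 hSP)
    rw [hPfr] at h1
    have h2 := Nat.mul_le_mul_left p h1
    rw [hN, ← pow_succ'] at h2
    exact (Nat.pow_le_pow_iff_right hp.one_lt).1 h2
  -- If `e ∈ P`, then `-e = π v` for some `v`, and `(v, w₀)` is an isotropic vector of π ⊥ dσ.
  · intro he
    obtain ⟨v, hv⟩ := (hmemP _).1 (neg_mem he)
    exact hw₀ (hsum v w₀ (by rw [hv, neg_add_cancel])).2
  · intro x
    rw [hφ.valueSpace_eq, mem_valueSpace_orthSum]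
    constructor
    · rintro ⟨a, ha, b, hb, rfl⟩
      obtain ⟨c, hc', rfl⟩ := mem_valueSpace_scale.1 hb
      refine ⟨a, (hmemP a).2 ha, (σ w₀)⁻¹ * c, ⟨c, hc', rfl⟩, ?_⟩
      field_simp
    · rintro ⟨a, ha, _, ⟨b, hb, rfl⟩, rfl⟩
      refine ⟨a, (hmemP a).1 ha, d * b, mem_valueSpace_scale.2 ⟨b, hb, rfl⟩, ?_⟩
      rw [LinearMap.mulLeft_apply]
      field_simp

end QuasiPfister

/-! ### Sufficiency of the bounds -/

section Realization

open Module IntermediateField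

variable {p : ℕ} [Fact p.Prime] {k F : Type*} [Field k] [Field F] [Algebra k F] [CharP F p]

/-- The dimensions allowed by `exists_finrank_span_image_eq` occur over subfields of `F`. -/
theorem exists_finrank_span_adjoin_eq (hk : ∀ x : F, x ^ p ∈ (algebraMap k F).range)
    {n s : ℕ} (P : IntermediateField k F) (hP : finrank k P = p ^ n) {S D : Submodule k F} {d : F}
    (hD : ∀ x, x ∈ D ↔ ∃ a ∈ P, ∃ b ∈ S, x = a + d * b) (hS : S ≤ P.toSubalgebra.toSubmodule)
    (h1 : (1 : F) ∈ S) (hs : finrank k S = s)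
    (hN : p * finrank k (adjoin k (S : Set F)) = p ^ s) (hsn : s ≤ n + 1) (hd : d ∉ P)
    {j l : ℕ} (hj : j ≤ n) (hl : l = 0 ∨ 1 ≤ l ∧ j + s ≤ l + n ∧ l ≤ s ∧ l ≤ p ^ j) :
    ∃ (r : ℕ) (b : Fin r → F), finrank (adjoin k (Set.range b))
      (Submodule.span (adjoin k (Set.range b)) (D : Set F)) = p ^ j + l := by
  have hp : p.Prime := Fact.out
  have hB : ∀ (B : IntermediateField k F) (x : F), x ^ p ∈ (algebraMap B F).range := fun B x => by
    obtain ⟨y, hy⟩ := hk x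
    exact ⟨algebraMap k B y, hy⟩
  have himage : ∀ s : Set F, (RingHom.id F) '' s = s := fun s => Set.image_id s
  obtain rfl | ⟨hl1, hl2, hl3, hl4⟩ := hl
  · obtain ⟨r, b, hdb, hfr⟩ := exists_adjoin_mem hk (j := j) (q := n - j)
      (by rw [hP]; congr 1; omega) hd
    refine ⟨r, b, ?_⟩
    have h := finrank_span_image_of_mem (hB (adjoin k (Set.range b))) (RingHom.id F) P hD hS
      (IntermediateField.algebraMap_mem _ (⟨d, hdb⟩ : adjoin k (Set.range b)))
    rwa [himage, himage, hfr] at h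
  -- `i` basis elements of `S` stay free, at most `j` by the degree and at most `l - 1` by the span.
  -- Either way `l ≤ p ^ i`, in the second case because `l - 1 < p ^ (l - 1)`.
  · obtain ⟨i, hij, hil, hi⟩ : ∃ i, i ≤ j ∧ i ≤ l - 1 ∧ (i = j ∨ i = l - 1) :=
      ⟨min j (l - 1), by omega, by omega, by omega⟩
    have hlp : l ≤ p ^ i := by
      obtain rfl | rfl := hi
      · exact hl4
      · have := Nat.lt_pow_self hp.one_lt (n := l - 1)
        omega
    -- The remaining `j - i` of the degree comes from generators of `P` over `k(S)`; there are `n +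
    -- 1 - s` of them, enough by `j + s ≤ l + n`.
    obtain ⟨r, b, hBP, hfr, hSfr⟩ := exists_adjoin_finrank_span hk hS h1 (j := i) (q := l - 1 - i)
      (r := s - l) (e := j - i) (g := n + 1 - s - (j - i)) (by rw [hP]; congr 1; omega)
      (by omega)
      (Nat.eq_of_mul_eq_mul_left hp.pos (by rw [hN, ← pow_succ']; congr 1; omega)) (by omega)
    refine ⟨r, b, ?_⟩
    rw [show i + (j - i) = j by omega] at hfr
    rw [show i + (l - 1 - i) + 1 = l by omega] at hSfr
    have hmem : d ∉ adjoin (adjoin k (Set.range b)) (P : Set F) := by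
      intro hmem
      have h2 := restrictScalars_adjoin_eq_sup k (adjoin k (Set.range b)) (P : Set F)
      rw [adjoin_self, sup_eq_right.2 hBP] at h2
      exact hd (h2 ▸ (mem_restrictScalars k).2 hmem)
    have hfd : FiniteDimensional (adjoin k (Set.range b))
        (adjoin (adjoin k (Set.range b)) (RingHom.id F '' (P : Set F))) := by
      rw [himage]
      exact Module.finite_of_finrank_pos (by rw [hfr]; exact pow_pos hp.pos _)
    have h := finrank_span_image_of_notMem (hB (adjoin k (Set.range b))) (RingHom.id F) P hD hS
      (by rw [himage]; exact hmem)
    rwa [himage, himage, himage, hfr, hSfr] at h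

end Realization

end PForm

/-! ### The main theorem -/

theorem mainTheorem2 (p : ℕ) [Fact p.Prime] {F : Type u} [Field F] [CharP F p]
    {V W U : Type*} [AddCommGroup V] [Module F V] [FiniteDimensional F V]
    [AddCommGroup W] [Module F W] [FiniteDimensional F W]
    [AddCommGroup U] [Module F U] [FiniteDimensional F U]
    (n : ℕ) (π : PForm p F V) (hπ : π.IsQuasiPfister n)
    (σ : PForm p F W) (hσ : σ.IsSubform π) (hmin : σ.IsMinimal)
    (hdim : 2 ≤ Module.finrank F W)
    (d : F) (hd : d ≠ 0)
    (φ : PForm p F U) (hφ : φ.Isometric (π.orthSum (σ.scale d))) (han : φ.Anisotropic) :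
    (∀ m : ℕ, m ∈ PForm.fullSplittingPattern.{u, v} φ ↔
      ∃ k l : ℕ, m = p ^ k + l ∧ k ≤ n ∧
        (l = 0 ∨
          (max 1 ((k : ℤ) - (n : ℤ) + (Module.finrank F W : ℤ)) ≤ (l : ℤ) ∧
            l ≤ min (Module.finrank F W) (p ^ k)))) ∧
    (∀ m ∈ PForm.fullSplittingPattern.{u, v} φ,
      ∃ (r : ℕ) (b : Fin r → F),
        IsPurelyInseparable F (PForm.pthRootField p b) ∧
        (∀ x : PForm.pthRootField p b,
          x ^ p ∈ (algebraMap F (PForm.pthRootField p b)).range) ∧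
        φ.AnisotropicDimOver (PForm.pthRootField p b) m) := by
  obtain ⟨P, S, e, hP, hSP, h1, hs, hN, hsn, he, hD⟩ :=
    PForm.exists_valueSpace_decomposition hπ hσ hmin hdim hφ han
  -- The lower bound is an integer, since `k - n + dim σ` may be negative; moving `n` across turns
  -- it into a condition on natural numbers.
  have hcond : ∀ k l : ℕ, (max 1 ((k : ℤ) - (n : ℤ) + (Module.finrank F W : ℤ)) ≤ (l : ℤ) ∧
      l ≤ min (Module.finrank F W) (p ^ k)) ↔
      1 ≤ l ∧ k + Module.finrank F W ≤ l + n ∧ l ≤ Module.finrank F W ∧ l ≤ p ^ k := by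
    intro k l
    rw [max_le_iff, le_min_iff]
    omega
  have hforward : ∀ m ∈ PForm.fullSplittingPattern.{u, v} φ,
      ∃ k l : ℕ, m = p ^ k + l ∧ k ≤ n ∧ (l = 0 ∨ 1 ≤ l ∧ k + Module.finrank F W ≤ l + n ∧
        l ≤ Module.finrank F W ∧ l ≤ p ^ k) := by
    rintro m ⟨E, _, _, hm⟩
    have : CharP E p := charP_of_injective_algebraMap (algebraMap F E).injective p
    rw [PForm.anisotropicDimOver_iff] at hm
    rw [← hm]
    refine PForm.exists_finrank_span_image_eq PForm.pow_mem_range_pPowers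
      PForm.pow_mem_range_pPowers (algebraMap F E) ?_ P hP hD hSP h1 hs hN
    rintro ⟨_, a, rfl⟩
    exact ⟨⟨_, algebraMap F E a, rfl⟩, (RingHom.map_pow _ _ _).symm⟩
  have hbackward : ∀ m : ℕ, (∃ k l : ℕ, m = p ^ k + l ∧ k ≤ n ∧ (l = 0 ∨ 1 ≤ l ∧
        k + Module.finrank F W ≤ l + n ∧ l ≤ Module.finrank F W ∧ l ≤ p ^ k)) →
      ∃ (r : ℕ) (b : Fin r → F), φ.AnisotropicDimOver (PForm.pthRootField p b) m := by
    rintro m ⟨k, l, rfl, hk, hl⟩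
    obtain ⟨r, b, hb⟩ := PForm.exists_finrank_span_adjoin_eq PForm.pow_mem_range_pPowers P hP hD
      hSP h1 hs hN hsn he hk hl
    exact ⟨r, b, (φ.anisotropicDimOver_pthRootField_iff b _).2 hb⟩
  refine ⟨fun m => ?_, fun m hm => ?_⟩
  · simp only [hcond]
    refine ⟨hforward m, fun h => ?_⟩
    obtain ⟨r, b, hb⟩ := hbackward m h
    exact PForm.mem_fullSplittingPattern_of_pthRootField hb
  · obtain ⟨r, b, hb⟩ := hbackward m (hforward m hm)
    exact ⟨r, b, PForm.isPurelyInseparable_pthRootField b,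
      PForm.pow_mem_range_of_pthRootField b, hb⟩
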